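/- Let $a\in\mathbb R$. In coordinates $(v,r,\vartheta,\psi)$ with $v\in\mathbb R$, $r>0$, $0<\vartheta<\pi$, $0<\psi<2\pi$, the Kerr-Vaidya metric with smooth mass function $M:\mathbb R\to\mathbb R$, where $M(v)>0$ and $|a|\le M(v)$ for all $v$, is $$ds^2=-\Big(1-\frac{2M(v)r}{\rho^2}\Big)dv^2+2\,dv\,dr-\frac{4M(v)ar\sin^2\vartheta}{\rho^2}\,dv\,d\psi-2a\sin^2\vartheta\,dr\,d\psi+\rho^2d\vartheta^2+\frac{\Gamma^2-\Delta a^2\sin^2\vartheta}{\rho^2}\sin^2\vartheta\,d\psi^2,$$ with $\rho^2=r^2+a^2\cos^2\vartheta$, $\Delta=r^2-2M(v)r+a^2$, $\Gamma=r^2+a^2$. A constant mass function $M(v)=m$ gives the stationary Kerr metric. The exterior of the ergoregion is the set $r>r_E(v,\vartheta)=M(v)+\sqrt{M(v)^2-a^2\cos^2\vartheta}$. A vector field $X^a$ is called Kodama-like on the whole exterior of the ergoregion if at every point of this set it is smooth, timelike ($X^aX_a<0$), divergence-free ($\nabla_aX^a=0$), tangent to the surfaces of constant $r$ ($X^a\nabla_a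 r=0$), and has a covariantly conserved current, $\nabla_a(G^{ab}X_b)=0$, where $G_{ab}$ is the Einstein tensor of the Kerr-Vaidya metric. A vector field $\xi^a$ on Kerr spacetime of mass $m$ is said to generalize to a Kodama-like vector field in Kerr-Vaidya if one can choose, for every mass function $M$ as above, a vector field $X_M^a$ that is Kodama-like on the whole exterior of the ergoregion of the Kerr-Vaidya spacetime of $M$, such that for the constant mass function $m$ the field $X_m^a$ equals $\xi^a$ on the exterior of the ergoregion. Let $m>0$, $|a|\le m$, and let $\xi^a$ be a smooth Killing vector field of the stationary Kerr metric of mass $m$ and rotation parameter $a$ (on the whole coordinate range above), $\nabla_a\xi_b+\nabla_b\xi_a=0$, that is timelike, $\xi^a\xi_a<0$, at some point at least. Then: (i) for every mass function $M$ as above, the vector field with the same coordinate components as $\xi^a$ is Kodama-like on the whole exterior of the ergoregion of the Kerr-Vaidya spacetime of $M$ if and only if $\xi^a$ is a constant multiple of $(\partial/\partial v)^a$; (ii) $\xi^a$ generalizes to a Kodama-like vector field in Kerr-Vaidya if and only if $\xi^a$ is a constant multiple of $(\partial/\partial v)^a$. (For $\xi=V\partial_v+\Psi\partial_\psi$ with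 constants $V,\Psi$, being a constant multiple of $\partial/\partial v$ just means $\Psi=0$.) -/

import Mathlib

open scoped ContDiff

namespace KerrVaidya

/-! Tensor calculus in one coordinate chart of a four-dimensional spacetime. -/

/-- Points of the coordinate space, in the order `(v, r, ϑ, ψ)`. -/
abbrev Coord := Fin 4 → ℝ

/-- A metric through its components `g_{μν}`, as a function of the point. -/
abbrev MetricField := Coord → Matrix (Fin 4) (Fin 4) ℝ

/-- A vector field through its contravariant components `X^μ`. -/
abbrev VectorField := Coord → Coord

noncomputable section

/-- The partial derivative `∂_μ f` at `p`. -/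
def pderiv (μ : Fin 4) (f : Coord → ℝ) (p : Coord) : ℝ :=
  fderiv ℝ f p (Pi.single μ 1)

/-- The Christoffel symbol `Γ^l_{μν}` of the Levi-Civita connection of `g`. -/
def christoffel (g : MetricField) (l μ ν : Fin 4) (p : Coord) : ℝ :=
  (1 / 2) * ∑ σ, (g p)⁻¹ l σ *
    (pderiv μ (fun q => g q σ ν) p + pderiv ν (fun q => g q σ μ) p
      - pderiv σ (fun q => g q μ ν) p)

/-- The Ricci tensor
`R_{μν} = ∂_l Γ^l_{μν} - ∂_ν Γ^l_{lμ} + Γ^l_{lσ} Γ^σ_{μν} - Γ^l_{νσ} Γ^σ_{lμ}`. -/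
def ricci (g : MetricField) (μ ν : Fin 4) (p : Coord) : ℝ :=
  (∑ l, pderiv l (christoffel g l μ ν) p) - (∑ l, pderiv ν (christoffel g l l μ) p)
    + (∑ l, ∑ σ, christoffel g l l σ p * christoffel g σ μ ν p)
    - ∑ l, ∑ σ, christoffel g l ν σ p * christoffel g σ l μ p

/-- The scalar curvature `R = g^{μν} R_{μν}`. -/
def scalarCurvature (g : MetricField) (p : Coord) : ℝ :=
  ∑ μ, ∑ ν, (g p)⁻¹ μ ν * ricci g μ ν p

/-- The Einstein tensor `G_{μν} = R_{μν} - (1/2) R g_{μν}`. -/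
def einstein (g : MetricField) (μ ν : Fin 4) (p : Coord) : ℝ :=
  ricci g μ ν p - (1 / 2) * scalarCurvature g p * g p μ ν

/-- The Einstein tensor with raised indices, `G^{μν} = g^{μα} g^{νβ} G_{αβ}`. -/
def einsteinUp (g : MetricField) (μ ν : Fin 4) (p : Coord) : ℝ :=
  ∑ α, ∑ β, (g p)⁻¹ μ α * (g p)⁻¹ ν β * einstein g α β p

/-- The covariant components `X_μ = g_{μν} X^ν`. -/
def lower (g : MetricField) (X : VectorField) (μ : Fin 4) (p : Coord) : ℝ :=
  ∑ ν, g p μ ν * X p ν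

/-- The covariant derivative `∇_μ X_ν = ∂_μ X_ν - Γ^l_{μν} X_l` of the lowered field. -/
def covDerivLower (g : MetricField) (X : VectorField) (μ ν : Fin 4) (p : Coord) : ℝ :=
  pderiv μ (lower g X ν) p - ∑ l, christoffel g l μ ν p * lower g X l p

/-- The covariant divergence `∇_μ X^μ = ∂_μ X^μ + Γ^μ_{μν} X^ν`. -/
def divergence (g : MetricField) (X : VectorField) (p : Coord) : ℝ :=
  (∑ μ, pderiv μ (fun q => X q μ) p) + ∑ μ, ∑ ν, christoffel g μ μ ν p * X p ν

/-- The squared norm `X^μ X_μ`. -/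
def normSq (g : MetricField) (X : VectorField) (p : Coord) : ℝ :=
  ∑ μ, X p μ * lower g X μ p

/-- The current `J^μ = G^{μν} X_ν` associated with `X`. -/
def current (g : MetricField) (X : VectorField) : VectorField :=
  fun p μ => ∑ ν, einsteinUp g μ ν p * lower g X ν p

/-- `X` is a smooth Killing vector field of `g` on `U`: `∇_μ X_ν + ∇_ν X_μ = 0`. -/
def IsKillingOn (g : MetricField) (X : VectorField) (U : Set Coord) : Prop :=
  ContDiffOn ℝ ∞ X U ∧
    ∀ p ∈ U, ∀ μ ν, covDerivLower g X μ ν p + covDerivLower g X ν μ p = 0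

/-! The Kerr-Vaidya spacetime in ingoing Eddington-Finkelstein-type coordinates. -/

/-- The range of the coordinates: `v ∈ ℝ`, `r > 0`, `0 < ϑ < π`, `0 < ψ < 2π`. -/
def chart : Set Coord :=
  {p | 0 < p 1 ∧ (0 < p 2 ∧ p 2 < Real.pi) ∧ (0 < p 3 ∧ p 3 < 2 * Real.pi)}

/-- `ρ² = r² + a² cos² ϑ`. -/
def rhoSq (a : ℝ) (p : Coord) : ℝ := p 1 ^ 2 + a ^ 2 * Real.cos (p 2) ^ 2

/-- `Δ = r² - 2 M(v) r + a²`. -/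
def Delta (a : ℝ) (M : ℝ → ℝ) (p : Coord) : ℝ := p 1 ^ 2 - 2 * M (p 0) * p 1 + a ^ 2

/-- `Γ = r² + a²`. -/
def Gam (a : ℝ) (p : Coord) : ℝ := p 1 ^ 2 + a ^ 2

/-- The Kerr-Vaidya metric with rotation parameter `a` and mass function `M`; for a constant
mass function it is the Kerr metric. -/
def metric (a : ℝ) (M : ℝ → ℝ) : MetricField := fun p =>
  let r := p 1
  let s := Real.sin (p 2) ^ 2
  !![-(1 - 2 * M (p 0) * r / rhoSq a p), 1, 0, -(2 * M (p 0) * a * r * s / rhoSq a p);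
     1, 0, 0, -(a * s);
     0, 0, rhoSq a p, 0;
     -(2 * M (p 0) * a * r * s / rhoSq a p), -(a * s), 0,
       (Gam a p ^ 2 - Delta a M p * a ^ 2 * s) / rhoSq a p * s]

/-- The admissible mass functions: smooth, positive and with `|a| ≤ M(v)`. -/
def IsMassFunction (a : ℝ) (M : ℝ → ℝ) : Prop :=
  ContDiff ℝ ∞ M ∧ ∀ v, 0 < M v ∧ |a| ≤ M v

/-- The outer boundary of the ergoregion, the larger root `r_E` of `r² + a² cos² ϑ = 2 M(v) r`. -/
def rErgo (a : ℝ) (M : ℝ → ℝ) (p : Coord) : ℝ :=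
  M (p 0) + Real.sqrt (M (p 0) ^ 2 - a ^ 2 * Real.cos (p 2) ^ 2)

/-- The exterior of the ergoregion, `r > r_E`. -/
def ergoExterior (a : ℝ) (M : ℝ → ℝ) : Set Coord := {p ∈ chart | rErgo a M p < p 1}

/-- `X` is a Kodama-like vector field of the Kerr-Vaidya spacetime on the whole exterior of the
ergoregion: it is smooth, timelike, divergence-free, tangent to the surfaces of constant `r`, and
its current `G^{μν} X_ν` is covariantly conserved. -/
structure IsKodamaLike (a : ℝ) (M : ℝ → ℝ) (X : VectorField) : Prop where
  smooth : ContDiffOn ℝ ∞ X (ergoExterior a M)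
  timelike : ∀ p ∈ ergoExterior a M, normSq (metric a M) X p < 0
  divergence_free : ∀ p ∈ ergoExterior a M, divergence (metric a M) X p = 0
  tangent : ∀ p ∈ ergoExterior a M, ∑ μ, X p μ * pderiv μ (fun q => q 1) p = 0
  conserved : ∀ p ∈ ergoExterior a M,
    divergence (metric a M) (current (metric a M) X) p = 0

/-- The coordinate vector field `K = ∂/∂v`. -/
def K : VectorField := fun _ => Pi.single 0 1

/-- A vector field `ξ` of the Kerr spacetime of mass `m` generalizes to a Kodama-like vector field
of the Kerr-Vaidya spacetimes: there is a choice of a vector field for every mass function that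
is Kodama-like for each admissible mass function and gives `ξ` back for the constant mass `m`. -/
def GeneralizesToKodamaLike (a m : ℝ) (ξ : VectorField) : Prop :=
  ∃ X : (ℝ → ℝ) → VectorField,
    Set.EqOn (X fun _ => m) ξ (ergoExterior a fun _ => m) ∧
      ∀ M, IsMassFunction a M → IsKodamaLike a M (X M)

end

end KerrVaidya

namespace KerrVaidya

/-! ### Partial derivatives -/

/-! The metric has Kerr-Schild form: a mass-free part plus `2 M r / ρ²` times the square of `dv - a
sin² ϑ dψ`. Hence `√|det g| = ρ² sin ϑ` contains no mass, and `ξ_r = ξ^v - a sin² ϑ ξ^ψ` (`radial`)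
controls everything below.

Every nonzero multiple of `∂/∂v` is Kodama-like for every `M`. The scalar curvature vanishes, the
current of `∂/∂v` is `G^μ_v`, and the explicit components have zero divergence
(`isKodamaLike_of_eqOn_K`). To make this a finite computation, the geometry is written in `Expr`, a
class of expressions closed under symbolic differentiation.

Conversely, timelikeness and tangency for `r > 2M(v)` already force a Killing field `ξ` to be a
multiple of `∂/∂v` (`eq_smul_K_of_timelike_tangent`). The `rr` Killing equation makes `A = ξ_r`
independent of `r`. With `ξ^r = 0`, a negative norm then forces `ξ^ϑ` and `sin ϑ ξ^ψ` to decay like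
`1/r` (`angular_bound`). The remaining Killing equations prescribe a growth in `r` that is
incompatible with this decay or with boundedness unless all derivatives of `A` vanish
(`fderiv_radial`). Once `A` is constant, `(ξ^ϑ)² + sin² ϑ (ξ^ψ)²` is conserved along radial lines,
and its decay makes it zero. Then `ξ^r` is also constant along radial lines, hence zero, and `ξ = A
∂/∂v`.

The Killing equation uses the mass `m` while the norm uses `M`; this does no harm, because the decay
estimate only needs the mass term of the norm to be nonnegative. -/

theorem HasFDerivAt.pderiv_eq {f : Coord → ℝ} {f' : Coord →L[ℝ] ℝ} {p : Coord}
    (h : HasFDerivAt f f' p) (μ : Fin 4) : pderiv μ f p = f' (Pi.single μ 1) := by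
  rw [pderiv, h.fderiv]

theorem pderiv_congr {f g : Coord → ℝ} {p : Coord} (h : f =ᶠ[nhds p] g) (μ : Fin 4) :
    pderiv μ f p = pderiv μ g p := by
  rw [pderiv, pderiv, h.fderiv_eq]

theorem pderiv_congr_on {f g : Coord → ℝ} {U : Set Coord} (hU : IsOpen U) (h : Set.EqOn f g U)
    {p : Coord} (hp : p ∈ U) (μ : Fin 4) : pderiv μ f p = pderiv μ g p :=
  pderiv_congr (Filter.eventuallyEq_of_mem (hU.mem_nhds hp) h) μ

theorem pderiv_const (c : ℝ) (μ : Fin 4) (p : Coord) : pderiv μ (fun _ => c) p = 0 := by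
  simp [pderiv]

theorem pderiv_sub {f g : Coord → ℝ} {p : Coord} (hf : DifferentiableAt ℝ f p)
    (hg : DifferentiableAt ℝ g p) (μ : Fin 4) :
    pderiv μ (fun q => f q - g q) p = pderiv μ f p - pderiv μ g p := by
  simp [pderiv, fderiv_fun_sub hf hg]

theorem pderiv_mul {f g : Coord → ℝ} {p : Coord} (hf : DifferentiableAt ℝ f p)
    (hg : DifferentiableAt ℝ g p) (μ : Fin 4) :
    pderiv μ (fun q => f q * g q) p = f p * pderiv μ g p + g p * pderiv μ f p := by
  simp [pderiv, fderiv_fun_mul hf hg]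

theorem pderiv_sum {ι : Type*} {s : Finset ι} {f : ι → Coord → ℝ} {p : Coord}
    (hf : ∀ i ∈ s, DifferentiableAt ℝ (f i) p) (μ : Fin 4) :
    pderiv μ (fun q => ∑ i ∈ s, f i q) p = ∑ i ∈ s, pderiv μ (f i) p := by
  simp [pderiv, fderiv_fun_sum hf]

theorem pderiv_coord (μ ν : Fin 4) (p : Coord) :
    pderiv μ (fun q => q ν) p = if μ = ν then 1 else 0 := by
  have h : HasFDerivAt (fun q : Coord => q ν) (ContinuousLinearMap.proj ν) p :=
    (ContinuousLinearMap.proj (R := ℝ) (φ := fun _ : Fin 4 => ℝ) ν).hasFDerivAt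
  rw [HasFDerivAt.pderiv_eq h]
  simp [Pi.single_apply, eq_comm]

theorem two_le_infty : (2 : WithTop ℕ∞) ≤ ∞ :=
  ENat.LEInfty.out

theorem pderiv_comm {f : Coord → ℝ} {p : Coord} (hf : ContDiffAt ℝ ∞ f p) (μ ν : Fin 4) :
    pderiv μ (pderiv ν f) p = pderiv ν (pderiv μ f) p := by
  have hd : DifferentiableAt ℝ (fderiv ℝ f) p :=
    ((hf.fderiv_right (m := 1) (by rw [one_add_one_eq_two]; exact two_le_infty)).differentiableAt one_ne_zero)
  have key : ∀ α β : Fin 4, pderiv α (pderiv β f) p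
      = fderiv ℝ (fderiv ℝ f) p (Pi.single α 1) (Pi.single β 1) := by
    intro α β
    have h2 : HasFDerivAt (pderiv β f)
        ((ContinuousLinearMap.apply ℝ ℝ (Pi.single β (1 : ℝ))).comp (fderiv ℝ (fderiv ℝ f) p)) p :=
      ((ContinuousLinearMap.apply ℝ ℝ (Pi.single β (1 : ℝ) : Coord)).hasFDerivAt
        (x := fderiv ℝ f p)).comp p hd.hasFDerivAt
    rw [HasFDerivAt.pderiv_eq h2]
    rfl
  rw [key, key]
  exact (hf.isSymmSndFDerivAt (by simpa using two_le_infty)) _ _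

theorem contDiffAt_pderiv {f : Coord → ℝ} {p : Coord} (hf : ContDiffAt ℝ ∞ f p) (μ : Fin 4) :
    ContDiffAt ℝ ∞ (pderiv μ f) p :=
  (hf.fderiv_right (m := ∞) (by simp)).clm_apply contDiffAt_const

/-- The derivative along a coordinate line is the partial derivative. -/
theorem hasDerivAt_update {f : Coord → ℝ} {p : Coord} {μ : Fin 4} {t : ℝ}
    (hf : DifferentiableAt ℝ f (Function.update p μ t)) :
    HasDerivAt (fun x => f (Function.update p μ x)) (pderiv μ f (Function.update p μ t)) t :=
  hf.hasFDerivAt.comp_hasDerivAt t (_root_.hasDerivAt_update p μ t)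

/-! ### The chart -/

theorem isOpen_chart : IsOpen chart := by
  have h : ∀ i : Fin 4, Continuous fun p : Coord => p i := continuous_apply
  refine (isOpen_lt continuous_const (h 1)).inter (IsOpen.inter ?_ ?_)
  · exact (isOpen_lt continuous_const (h 2)).inter (isOpen_lt (h 2) continuous_const)
  · exact (isOpen_lt continuous_const (h 3)).inter (isOpen_lt (h 3) continuous_const)

theorem sin_pos_of_mem_chart {p : Coord} (hp : p ∈ chart) : 0 < Real.sin (p 2) :=
  Real.sin_pos_of_pos_of_lt_pi hp.2.1.1 hp.2.1.2

theorem rhoSq_pos {a : ℝ} {p : Coord} (hp : p ∈ chart) : 0 < rhoSq a p := by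
  have := hp.1
  unfold rhoSq
  positivity

/-! ### Coordinate expressions and their symbolic derivatives -/

/-- Formal expressions in `r`, `cos ϑ`, `sin ϑ`, `1 / ρ²`, `1 / sin ϑ` and the derivatives of the
mass function. -/
inductive Expr where
  | const (x : ℝ)
  | r
  | c
  | s
  | w
  | k
  | mass (n : ℕ)
  | add (e f : Expr)
  | mul (e f : Expr)

namespace Expr

instance : Add Expr := ⟨add⟩
instance : Mul Expr := ⟨mul⟩
instance : Zero Expr := ⟨const 0⟩
instance : One Expr := ⟨const 1⟩
noncomputable instance : Neg Expr := ⟨fun e => const (-1) * e⟩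
noncomputable instance : Sub Expr := ⟨fun e f => e + -f⟩

/-- The value of an expression at a point. -/
noncomputable def eval (a : ℝ) (M : ℝ → ℝ) : Expr → Coord → ℝ
  | const x, _ => x
  | r, p => p 1
  | c, p => Real.cos (p 2)
  | s, p => Real.sin (p 2)
  | w, p => (rhoSq a p)⁻¹
  | k, p => (Real.sin (p 2))⁻¹
  | mass n, p => iteratedDeriv n M (p 0)
  | add e f, p => eval a M e p + eval a M f p
  | mul e f, p => eval a M e p * eval a M f p

/-- The symbolic partial derivative of an expression. -/
noncomputable def diff (a : ℝ) (μ : Fin 4) : Expr → Expr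
  | const _ => 0
  | r => if μ = 1 then 1 else 0
  | c => if μ = 2 then -s else 0
  | s => if μ = 2 then c else 0
  | w => if μ = 1 then const (-2) * r * w * w
      else if μ = 2 then const (2 * a ^ 2) * c * s * w * w else 0
  | k => if μ = 2 then -(c * k * k) else 0
  | mass n => if μ = 0 then mass (n + 1) else 0
  | add e f => diff a μ e + diff a μ f
  | mul e f => e * diff a μ f + f * diff a μ e

variable (a : ℝ) (M : ℝ → ℝ) (p : Coord) (e f : Expr) (x : ℝ) (n : ℕ) (μ : Fin 4)

@[simp] theorem eval_const : (const x).eval a M p = x := rfl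
@[simp] theorem eval_r : r.eval a M p = p 1 := rfl
@[simp] theorem eval_c : c.eval a M p = Real.cos (p 2) := rfl
@[simp] theorem eval_s : s.eval a M p = Real.sin (p 2) := rfl
@[simp] theorem eval_w : w.eval a M p = (rhoSq a p)⁻¹ := rfl
@[simp] theorem eval_k : k.eval a M p = (Real.sin (p 2))⁻¹ := rfl
@[simp] theorem eval_mass : (mass n).eval a M p = iteratedDeriv n M (p 0) := rfl
@[simp] theorem eval_zero : (0 : Expr).eval a M p = 0 := rfl
@[simp] theorem eval_one : (1 : Expr).eval a M p = 1 := rfl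
@[simp] theorem eval_add : (e + f).eval a M p = e.eval a M p + f.eval a M p := rfl
@[simp] theorem eval_mul : (e * f).eval a M p = e.eval a M p * f.eval a M p := rfl
@[simp] theorem eval_neg : (-e).eval a M p = -e.eval a M p := by
  change (-1) * e.eval a M p = _
  ring
@[simp] theorem eval_sub : (e - f).eval a M p = e.eval a M p - f.eval a M p := by
  change e.eval a M p + (-f).eval a M p = _
  rw [eval_neg, sub_eq_add_neg]

@[simp] theorem diff_const : (const x).diff a μ = 0 := rfl
@[simp] theorem diff_zero : (0 : Expr).diff a μ = 0 := rfl
@[simp] theorem diff_one : (1 : Expr).diff a μ = 0 := rfl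
@[simp] theorem diff_r : r.diff a μ = if μ = 1 then 1 else 0 := rfl
@[simp] theorem diff_c : c.diff a μ = if μ = 2 then -s else 0 := rfl
@[simp] theorem diff_s : s.diff a μ = if μ = 2 then c else 0 := rfl
@[simp] theorem diff_w : w.diff a μ = if μ = 1 then const (-2) * r * w * w
    else if μ = 2 then const (2 * a ^ 2) * c * s * w * w else 0 := rfl
@[simp] theorem diff_k : k.diff a μ = if μ = 2 then -(c * k * k) else 0 := rfl
@[simp] theorem diff_mass : (mass n).diff a μ = if μ = 0 then mass (n + 1) else 0 := rfl
@[simp] theorem diff_add : (e + f).diff a μ = e.diff a μ + f.diff a μ := rfl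
@[simp] theorem diff_mul : (e * f).diff a μ = e * f.diff a μ + f * e.diff a μ := rfl
@[simp] theorem diff_neg : (-e).diff a μ = const (-1) * e.diff a μ + e * 0 := rfl
@[simp] theorem diff_sub : (e - f).diff a μ = e.diff a μ + (-f).diff a μ := rfl

variable {M p}

/-- The symbolic derivatives of an expression are its partial derivatives. -/
theorem hasFDerivAt_eval (hM : ContDiff ℝ ∞ M) (hp : p ∈ chart) :
    HasFDerivAt (e.eval a M)
      (∑ μ, (e.diff a μ).eval a M p • ContinuousLinearMap.proj (R := ℝ) (φ := fun _ => ℝ) μ) p := by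
  have hcoord : ∀ i : Fin 4, HasFDerivAt (fun q : Coord => q i)
      (ContinuousLinearMap.proj (R := ℝ) (φ := fun _ => ℝ) i) p := fun i =>
    (ContinuousLinearMap.proj (R := ℝ) (φ := fun _ : Fin 4 => ℝ) i).hasFDerivAt
  have hcos := (hcoord 2).cos
  have hsin := (hcoord 2).sin
  induction e with
  | const x => simpa [eval] using! hasFDerivAt_const x p
  | r => simpa [eval, Fin.sum_univ_four] using! hcoord 1
  | c => simpa [eval, Fin.sum_univ_four] using! hcos
  | s => simpa [eval, Fin.sum_univ_four] using! hsin
  | w =>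
    have h : HasFDerivAt (rhoSq a) _ p := ((hcoord 1).pow 2).add ((hcos.pow 2).const_mul (a ^ 2))
    have h2 := (hasDerivAt_inv (rhoSq_pos hp).ne').comp_hasFDerivAt p h
    refine h2.congr_fderiv ?_
    ext v
    simp [Fin.sum_univ_four]
    ring
  | k =>
    have h2 := (hasDerivAt_inv (sin_pos_of_mem_chart hp).ne').comp_hasFDerivAt p hsin
    refine h2.congr_fderiv ?_
    ext v
    simp [Fin.sum_univ_four]
    ring
  | mass n =>
    have h : HasDerivAt (iteratedDeriv n M) (iteratedDeriv (n + 1) M (p 0)) (p 0) := by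
      rw [iteratedDeriv_succ]
      exact ((hM.differentiable_iteratedDeriv n (by exact_mod_cast WithTop.coe_lt_top _)) _).hasDerivAt
    simpa [eval, Fin.sum_univ_four] using! h.comp_hasFDerivAt p (hcoord 0)
  | add e f he hf =>
    refine (he.add hf).congr_fderiv ?_
    change _ = ∑ μ, ((e + f).diff a μ).eval a M p • _
    simp [add_smul, Finset.sum_add_distrib]
  | mul e f he hf =>
    refine (he.mul hf).congr_fderiv ?_
    change _ = ∑ μ, ((e * f).diff a μ).eval a M p • _
    simp [add_smul, mul_smul, Finset.sum_add_distrib, Finset.smul_sum]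

/-- This reduces each derivative of the metric, the connection and the current to simplification
followed by `field_simp` and `ring`. -/
theorem pderiv_eval (hM : ContDiff ℝ ∞ M) (hp : p ∈ chart) :
    pderiv μ (e.eval a M) p = (e.diff a μ).eval a M p := by
  rw [HasFDerivAt.pderiv_eq (e.hasFDerivAt_eval a hM hp)]
  simp [Pi.single_apply]

theorem differentiableAt_eval (hM : ContDiff ℝ ∞ M) (hp : p ∈ chart) :
    DifferentiableAt ℝ (e.eval a M) p :=
  (e.hasFDerivAt_eval a hM hp).differentiableAt

end Expr

noncomputable section

/-! ### The Kerr-Vaidya metric and its connection -/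

namespace Expr

/-- The Kerr-Schild potential `M r / ρ²`. -/
def pot : Expr := mass 0 * r * w

/-- The `v`-derivative of the Kerr-Schild potential. -/
def potV : Expr := mass 1 * r * w

/-- The `r`-derivative of the Kerr-Schild potential. -/
def potR : Expr := mass 0 * (w - const 2 * r * r * w * w)

/-- The `ϑ`-derivative of the Kerr-Schild potential. -/
def potTheta (a : ℝ) : Expr := const (2 * a ^ 2) * mass 0 * r * c * s * w * w

/-- `Γ = r² + a²` as an expression. -/
def gam (a : ℝ) : Expr := r * r + const (a ^ 2)

/-- `ρ²` as an expression. -/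
def rho (a : ℝ) : Expr := r * r + const (a ^ 2) * c * c

/-- `Δ` as an expression. -/
def del (a : ℝ) : Expr := gam a - const 2 * mass 0 * r

/-- The metric components as expressions. -/
def metric (a : ℝ) : Matrix (Fin 4) (Fin 4) Expr :=
  !![const 2 * pot - 1, 1, 0, const (-2 * a) * pot * s * s;
     1, 0, 0, const (-a) * s * s;
     0, 0, rho a, 0;
     const (-2 * a) * pot * s * s, const (-a) * s * s, 0,
       (gam a + const (2 * a ^ 2) * pot * s * s) * s * s]

/-- The components of the inverse metric as expressions. -/
def inverse (a : ℝ) : Matrix (Fin 4) (Fin 4) Expr :=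
  !![const (a ^ 2) * s * s * w, gam a * w, 0, const a * w;
     gam a * w, del a * w, 0, const a * w;
     0, 0, w, 0;
     const a * w, const a * w, 0, w * k * k]

/-- The Christoffel symbols `Γ^l_{μν}` as expressions. -/
def chr (a : ℝ) : Fin 4 → Matrix (Fin 4) (Fin 4) Expr :=
  ![!![-(w * (const (a ^ 2) * s * s * potV + gam a * potR)), 0,
        const (-2 * a ^ 2) * s * c * pot * w,
        const a * s * s * w * (gam a * potR + const (a ^ 2) * s * s * potV);
      0, 0, const (-a ^ 2) * s * c * w, const a * r * s * s * w;
      const (-2 * a ^ 2) * s * c * pot * w, const (-a ^ 2) * s * c * w, -(gam a * r * w),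
        const (2 * a ^ 3) * s * s * s * c * pot * w;
      const a * s * s * w * (gam a * potR + const (a ^ 2) * s * s * potV), const a * r * s * s * w,
        const (2 * a ^ 3) * s * s * s * c * pot * w,
        -(s * s * w * (const (a ^ 4) * s * s * s * s * potV
          + gam a * (r + const (a ^ 2) * s * s * potR)))],
    !![w * ((gam a - const (2 * a ^ 2) * s * s) * potV - del a * potR), potR, 0,
        const a * s * s * w * (del a * potR + const (a ^ 2) * s * s * potV);
      potR, 0, const (-a ^ 2) * s * c * w, const a * s * s * (r * w - potR);
      0, const (-a ^ 2) * s * c * w, -(del a * r * w), 0;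
      const a * s * s * w * (del a * potR + const (a ^ 2) * s * s * potV),
        const a * s * s * (r * w - potR), 0,
        -(s * s * w * (gam a * const (a ^ 2) * s * s * potV
          + del a * (r + const (a ^ 2) * s * s * potR)))],
    !![-(w * potTheta a), 0, 0, w * (const a * s * s * potTheta a + const (2 * a) * s * c * pot);
      0, 0, r * w, const a * s * c * w;
      0, r * w, const (-a ^ 2) * s * c * w, 0;
      w * (const a * s * s * potTheta a + const (2 * a) * s * c * pot), const a * s * c * w, 0,
        -(w * (gam a * s * c + const (a ^ 2) * s * s * s * s * potTheta a
          + const (4 * a ^ 2) * s * s * s * c * pot))],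
    !![const (-a) * w * (potV + potR), 0, const (-2 * a) * w * c * k * pot,
        const (a ^ 2) * s * s * w * (potV + potR);
      0, 0, const (-a) * w * c * k, r * w;
      const (-2 * a) * w * c * k * pot, const (-a) * w * c * k, const (-a) * w * r,
        c * k + const (2 * a ^ 2) * s * c * pot * w;
      const (a ^ 2) * s * s * w * (potV + potR), r * w,
        c * k + const (2 * a ^ 2) * s * c * pot * w,
        const (-a) * s * s * w * (const (a ^ 2) * s * s * potV + r
          + const (a ^ 2) * s * s * potR)]]

/-- The contracted Christoffel symbols `Γ^l_{lμ}` as expressions. -/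
def chrTrace (a : ℝ) : Fin 4 → Expr :=
  ![0, const 2 * r * w, c * k - const (2 * a ^ 2) * s * c * w, 0]

end Expr

variable {a m : ℝ} {M : ℝ → ℝ} {p : Coord} {ξ : VectorField}

theorem cos_sq_eq (p : Coord) : Real.cos (p 2) ^ 2 = 1 - Real.sin (p 2) ^ 2 :=
  Real.cos_sq' _

theorem metric_eq_eval (hp : p ∈ chart) (μ ν : Fin 4) :
    metric a M p μ ν = (Expr.metric a μ ν).eval a M p := by
  have h := (rhoSq_pos (a := a) hp).ne'
  have hc := cos_sq_eq p
  fin_cases μ <;> fin_cases ν <;>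
    simp [metric, Expr.metric, Expr.pot, Expr.rho, Expr.gam, Gam, Delta]
  all_goals try field_simp
  all_goals first
    | ring1
    | (simp only [rhoSq, hc]; ring1)
    | simp only [rhoSq, hc]

theorem metric_mul_inverse (hp : p ∈ chart) :
    metric a M p * Matrix.of (fun μ ν => (Expr.inverse a μ ν).eval a M p) = 1 := by
  have h := (rhoSq_pos (a := a) hp).ne'
  have hs := (sin_pos_of_mem_chart hp).ne'
  have hc := cos_sq_eq p
  ext μ ν
  simp only [Matrix.mul_apply, Fin.sum_univ_four, metric_eq_eval hp, Matrix.of_apply]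
  fin_cases μ <;> fin_cases ν <;>
    simp [Expr.metric, Expr.inverse, Expr.pot, Expr.rho, Expr.gam, Expr.del]
  all_goals try field_simp
  all_goals first
    | ring1
    | (simp only [rhoSq, hc]; ring1)
    | simp only [rhoSq, hc]

theorem metric_inv (hp : p ∈ chart) (μ ν : Fin 4) :
    (metric a M p)⁻¹ μ ν = (Expr.inverse a μ ν).eval a M p := by
  rw [Matrix.inv_eq_right_inv (metric_mul_inverse hp)]
  rfl

theorem metric_symm (a : ℝ) (M : ℝ → ℝ) (p : Coord) (μ ν : Fin 4) :
    metric a M p μ ν = metric a M p ν μ := by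
  fin_cases μ <;> fin_cases ν <;> rfl

theorem pderiv_metric (hM : ContDiff ℝ ∞ M) (hp : p ∈ chart) (l μ ν : Fin 4) :
    pderiv l (fun q => metric a M q μ ν) p = ((Expr.metric a μ ν).diff a l).eval a M p := by
  rw [← Expr.pderiv_eval a _ _ hM hp]
  exact pderiv_congr_on isOpen_chart (fun q hq => metric_eq_eval hq μ ν) hp l

set_option maxHeartbeats 1000000 in
theorem christoffel_metric (hM : ContDiff ℝ ∞ M) (hp : p ∈ chart) (l μ ν : Fin 4) :
    christoffel (metric a M) l μ ν p = (Expr.chr a l μ ν).eval a M p := by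
  have h := (rhoSq_pos (a := a) hp).ne'
  have hs := (sin_pos_of_mem_chart hp).ne'
  have hc := cos_sq_eq p
  simp only [christoffel, metric_inv hp, pderiv_metric hM hp, Fin.sum_univ_four]
  fin_cases l <;> fin_cases μ <;> fin_cases ν <;>
    simp [Expr.metric, Expr.inverse, Expr.chr, Expr.pot, Expr.potV, Expr.potR, Expr.potTheta,
      Expr.rho, Expr.gam, Expr.del]
  all_goals try field_simp
  all_goals first
    | ring1
    | (simp only [rhoSq, hc]; ring1)

/-- These traces are the logarithmic derivatives of `√|det g| = ρ² sin ϑ`, so the mass cancels. -/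
theorem christoffel_trace (hM : ContDiff ℝ ∞ M) (hp : p ∈ chart) (μ : Fin 4) :
    ∑ l, christoffel (metric a M) l l μ p = (Expr.chrTrace a μ).eval a M p := by
  have h := (rhoSq_pos (a := a) hp).ne'
  have hs := (sin_pos_of_mem_chart hp).ne'
  have hc := cos_sq_eq p
  simp only [christoffel_metric hM hp, Fin.sum_univ_four]
  fin_cases μ <;>
    simp [Expr.chr, Expr.pot, Expr.potV, Expr.potR, Expr.potTheta, Expr.gam, Expr.chrTrace]
  all_goals try field_simp
  all_goals first
    | ring1
    | (simp only [rhoSq, hc]; ring1)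

theorem pderiv_christoffel (hM : ContDiff ℝ ∞ M) (hp : p ∈ chart) (κ l μ ν : Fin 4) :
    pderiv κ (christoffel (metric a M) l μ ν) p = ((Expr.chr a l μ ν).diff a κ).eval a M p := by
  rw [← Expr.pderiv_eval a _ _ hM hp]
  exact pderiv_congr_on isOpen_chart (fun q hq => christoffel_metric hM hq l μ ν) hp κ

theorem pderiv_christoffel_trace (hM : ContDiff ℝ ∞ M) (hp : p ∈ chart) (μ ν : Fin 4) :
    ∑ l, pderiv ν (christoffel (metric a M) l l μ) p
      = ((Expr.chrTrace a μ).diff a ν).eval a M p := by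
  have hd : ∀ l ∈ Finset.univ, DifferentiableAt ℝ (christoffel (metric a M) l l μ) p := fun l _ =>
    (Expr.differentiableAt_eval a _ hM hp).congr_of_eventuallyEq
      (Filter.eventuallyEq_of_mem (isOpen_chart.mem_nhds hp)
        fun q hq => christoffel_metric hM hq l l μ)
  rw [← Expr.pderiv_eval a _ _ hM hp, ← pderiv_sum hd]
  exact pderiv_congr_on isOpen_chart (fun q hq => christoffel_trace hM hq μ) hp ν

/-! ### Ricci and Einstein tensors of the Kerr-Vaidya metric. -/

theorem ricci_metric (hM : ContDiff ℝ ∞ M) (hp : p ∈ chart) (μ ν : Fin 4) :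
    ricci (metric a M) μ ν p =
      (∑ l, (((Expr.chr a l μ ν).diff a l).eval a M p
        + (Expr.chrTrace a l).eval a M p * (Expr.chr a l μ ν).eval a M p))
      - ((Expr.chrTrace a μ).diff a ν).eval a M p
      - ∑ l, ∑ σ, (Expr.chr a l ν σ).eval a M p * (Expr.chr a σ l μ).eval a M p := by
  have h : ∑ l, ∑ σ, christoffel (metric a M) l l σ p * christoffel (metric a M) σ μ ν p
      = ∑ σ, (Expr.chrTrace a σ).eval a M p * (Expr.chr a σ μ ν).eval a M p := by
    rw [Finset.sum_comm]
    simp_rw [← Finset.sum_mul, christoffel_trace hM hp, christoffel_metric hM hp]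
  rw [ricci, h, pderiv_christoffel_trace hM hp]
  simp only [pderiv_christoffel hM hp, christoffel_metric hM hp, Finset.sum_add_distrib]
  ring

theorem chrTrace_diff_symm (μ ν : Fin 4) :
    ((Expr.chrTrace a μ).diff a ν).eval a M p = ((Expr.chrTrace a ν).diff a μ).eval a M p := by
  fin_cases μ <;> fin_cases ν <;> simp [Expr.chrTrace]
  all_goals ring

theorem ricci_metric_symm (hM : ContDiff ℝ ∞ M) (hp : p ∈ chart) (μ ν : Fin 4) :
    ricci (metric a M) μ ν p = ricci (metric a M) ν μ p := by
  have h : ∀ l α β : Fin 4, Expr.chr a l α β = Expr.chr a l β α := by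
    intro l α β
    fin_cases l <;> fin_cases α <;> fin_cases β <;> rfl
  rw [ricci_metric hM hp, ricci_metric hM hp, chrTrace_diff_symm]
  congr 1
  · simp_rw [fun l => h l μ ν]
  · rw [Finset.sum_comm]
    refine Finset.sum_congr rfl fun σ _ => Finset.sum_congr rfl fun l _ => ?_
    rw [mul_comm, h σ l μ, h l ν σ]

namespace Expr

/-- The component `R_{vv}` of the Ricci tensor as an expression. -/
def ricVV (a : ℝ) : Expr :=
  const 2 * mass 1 * w * w * (const 2 * r * r * w * gam a - const (a ^ 2) * s * s - r * r)
    - const (a ^ 2) * s * s * r * w * w * mass 2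

/-- The component `R_{vϑ}` of the Ricci tensor as an expression. -/
def ricVTheta (a : ℝ) : Expr := const (-2 * a ^ 2) * r * c * s * w * w * mass 1

/-- The `v`-derivative of `potR` as an expression. -/
def potVR : Expr := mass 1 * (w - const 2 * r * r * w * w)

/-- The Ricci tensor as expressions. -/
def ric (a : ℝ) : Matrix (Fin 4) (Fin 4) Expr :=
  !![ricVV a, 0, ricVTheta a, const a * s * s * (potVR - ricVV a);
     0, 0, 0, 0;
     ricVTheta a, 0, 0, const (-a) * s * s * ricVTheta a;
     const a * s * s * (potVR - ricVV a), 0, const (-a) * s * s * ricVTheta a,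
       const (a ^ 2) * s * s * s * s * (ricVV a - const 2 * potVR)]

end Expr

set_option maxHeartbeats 4000000 in
theorem ricci_metric_eq (hM : ContDiff ℝ ∞ M) (hp : p ∈ chart) (μ ν : Fin 4) :
    ricci (metric a M) μ ν p = (Expr.ric a μ ν).eval a M p := by
  wlog hμν : μ ≤ ν generalizing μ ν
  · rw [ricci_metric_symm hM hp, this ν μ (le_of_not_ge hμν)]
    fin_cases μ <;> fin_cases ν <;> rfl
  have h := (rhoSq_pos (a := a) hp).ne'
  have hs := (sin_pos_of_mem_chart hp).ne'
  have h2 := Real.sin_sq (p 2)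
  -- Even powers of the sine are eliminated in favour of the cosine that occurs in `ρ²`, which
  -- leaves polynomial identities.
  have h4 : Real.sin (p 2) ^ 4 = (1 - Real.cos (p 2) ^ 2) ^ 2 := by
    rw [← h2]
    ring
  simp only [ricci_metric hM hp, Fin.sum_univ_four]
  fin_cases μ <;> fin_cases ν <;> first
    | exact absurd hμν (by decide)
    | simp [Expr.chr, Expr.pot, Expr.potV, Expr.potR, Expr.potTheta, Expr.gam, Expr.del,
        Expr.chrTrace, Expr.ric, Expr.ricVV, Expr.ricVTheta, Expr.potVR]
  all_goals try field_simp
  all_goals first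
    | ring1
    | (simp only [rhoSq, h2, h4]; ring1)

/-- Only the `vv`, `vψ` and `ψψ` terms enter the trace, and they cancel; the Einstein tensor is
therefore the Ricci tensor. -/
theorem scalarCurvature_metric (hM : ContDiff ℝ ∞ M) (hp : p ∈ chart) :
    scalarCurvature (metric a M) p = 0 := by
  have h := (rhoSq_pos (a := a) hp).ne'
  have hs := (sin_pos_of_mem_chart hp).ne'
  simp only [scalarCurvature, metric_inv hp, ricci_metric_eq hM hp, Fin.sum_univ_four]
  simp [Expr.inverse, Expr.ric]
  field_simp
  ring

theorem einstein_metric (hM : ContDiff ℝ ∞ M) (hp : p ∈ chart) (μ ν : Fin 4) :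
    einstein (metric a M) μ ν p = (Expr.ric a μ ν).eval a M p := by
  rw [einstein, scalarCurvature_metric hM hp, ricci_metric_eq hM hp]
  ring

/-- The current `G^{μν} K_ν` of `K = ∂/∂v` as expressions. -/
def Expr.cur (a : ℝ) : Fin 4 → Expr :=
  ![const (a ^ 2) * s * s * w * potVR,
    mass 1 * w * w * (const 2 * r * r * w * gam a - const (a ^ 2) * s * s)
      - const (a ^ 2) * s * s * r * w * w * mass 2,
    ricVTheta a * w,
    const a * w * potVR]

/-! ### Multiples of `∂/∂v` are Kodama-like. -/

theorem lower_of_eqOn_K {X : VectorField} {c : ℝ} (hX : X p = c • K p) (μ : Fin 4) :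
    lower (metric a M) X μ p = c * metric a M p μ 0 := by
  simp [lower, hX, K, Fin.sum_univ_four, mul_comm]

/-- Since `K_ν = g_{νv}`, lowering undoes one of the two raised indices and the current of `K` is
`G^μ_v`. -/
theorem einsteinUp_contract_lower (hp : p ∈ chart) (μ : Fin 4) :
    ∑ ν, einsteinUp (metric a M) μ ν p * metric a M p ν 0
      = ∑ α, (metric a M p)⁻¹ μ α * einstein (metric a M) α 0 p := by
  have hinv : metric a M p * (metric a M p)⁻¹ = 1 := by
    rw [Matrix.inv_eq_right_inv (metric_mul_inverse hp)]
    exact metric_mul_inverse hp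
  have hsymm : ∀ β : Fin 4, ∑ ν, (metric a M p)⁻¹ ν β * metric a M p ν 0
      = if (0 : Fin 4) = β then 1 else 0 := by
    intro β
    have h1 := congrFun (congrFun hinv 0) β
    rw [Matrix.mul_apply, Matrix.one_apply] at h1
    rw [← h1]
    exact Finset.sum_congr rfl fun ν _ => by rw [metric_symm a M p ν 0, mul_comm]
  simp only [einsteinUp, Finset.sum_mul]
  rw [Finset.sum_comm]
  refine Finset.sum_congr rfl fun α _ => ?_
  rw [Finset.sum_comm]
  calc _ = ∑ β, (metric a M p)⁻¹ μ α * einstein (metric a M) α β p *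
        ∑ ν, (metric a M p)⁻¹ ν β * metric a M p ν 0 := by
        refine Finset.sum_congr rfl fun β _ => ?_
        rw [Finset.mul_sum]
        exact Finset.sum_congr rfl fun ν _ => by ring
    _ = _ := by simp [hsymm]

theorem current_of_eqOn_K (hM : ContDiff ℝ ∞ M) {X : VectorField} {c : ℝ} (hp : p ∈ chart)
    (hX : X p = c • K p) (μ : Fin 4) :
    current (metric a M) X p μ = (Expr.const c * Expr.cur a μ).eval a M p := by
  have h := (rhoSq_pos (a := a) hp).ne'
  have hs := (sin_pos_of_mem_chart hp).ne'
  have hc := cos_sq_eq p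
  have h1 : current (metric a M) X p μ
      = c * ∑ ν, einsteinUp (metric a M) μ ν p * metric a M p ν 0 := by
    simp only [current, lower_of_eqOn_K hX, Finset.mul_sum]
    exact Finset.sum_congr rfl fun ν _ => by ring
  rw [h1, einsteinUp_contract_lower hp, Expr.eval_mul, Expr.eval_const]
  congr 1
  simp only [metric_inv hp, einstein_metric hM hp, Fin.sum_univ_four]
  fin_cases μ <;>
    simp [Expr.inverse, Expr.ric, Expr.cur, Expr.ricVV, Expr.ricVTheta, Expr.potVR, Expr.gam]
  all_goals try field_simp
  all_goals first
    | ring1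
    | (simp only [rhoSq, hc]; ring1)

theorem divergence_metric (hM : ContDiff ℝ ∞ M) (hp : p ∈ chart) (X : VectorField) :
    divergence (metric a M) X p
      = ∑ μ, (pderiv μ (fun q => X q μ) p + (Expr.chrTrace a μ).eval a M p * X p μ) := by
  rw [divergence, Finset.sum_add_distrib, Finset.sum_comm]
  congr 1
  exact Finset.sum_congr rfl fun ν _ => by rw [← Finset.sum_mul, christoffel_trace hM hp]

theorem divergence_of_eqOn_K (hM : ContDiff ℝ ∞ M) {X : VectorField} {c : ℝ}
    (hX : ∀ q ∈ chart, X q = c • K q) (hp : p ∈ chart) :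
    divergence (metric a M) X p = 0 := by
  rw [divergence_metric hM hp]
  refine Finset.sum_eq_zero fun μ _ => ?_
  have h1 : pderiv μ (fun q => X q μ) p = 0 := by
    rw [← pderiv_const (c * (Pi.single 0 1 : Coord) μ) μ p]
    exact pderiv_congr_on isOpen_chart (fun q hq => by simp [hX q hq, K]) hp μ
  rw [h1, hX p hp]
  fin_cases μ <;> simp [K, Expr.chrTrace]

/-- The `M''` terms cancel between the `v` and `r` components of the current, the `M'` terms between
the `r` and `ϑ` components. The `ψ` component does not depend on `ψ`. -/
theorem divergence_current_of_eqOn_K (hM : ContDiff ℝ ∞ M) {X : VectorField} {c : ℝ}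
    (hX : ∀ q ∈ chart, X q = c • K q) (hp : p ∈ chart) :
    divergence (metric a M) (current (metric a M) X) p = 0 := by
  have h := (rhoSq_pos (a := a) hp).ne'
  have hs := (sin_pos_of_mem_chart hp).ne'
  have hc := cos_sq_eq p
  have hd : ∀ μ, pderiv μ (fun q => current (metric a M) X q μ) p
      = ((Expr.const c * Expr.cur a μ).diff a μ).eval a M p := by
    intro μ
    rw [← Expr.pderiv_eval a _ _ hM hp]
    exact pderiv_congr_on isOpen_chart (fun q hq => current_of_eqOn_K hM hq (hX q hq) μ) hp μ
  simp only [divergence_metric hM hp, hd, current_of_eqOn_K hM hp (hX p hp), Fin.sum_univ_four]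
  simp [Expr.chrTrace, Expr.cur, Expr.ricVTheta, Expr.potVR, Expr.gam]
  field_simp
  simp only [rhoSq, hc]
  ring

/-- Beyond the larger root, squaring `r - M > √(M² - a² cos² ϑ)` gives the sign of the quadratic
polynomial. -/
theorem two_mul_mass_mul_lt_rhoSq (hp : p ∈ ergoExterior a M) :
    2 * M (p 0) * p 1 < rhoSq a p := by
  have h1 : Real.sqrt (M (p 0) ^ 2 - a ^ 2 * Real.cos (p 2) ^ 2) < p 1 - M (p 0) := by
    have := hp.2
    unfold rErgo at this
    linarith
  have h2 : M (p 0) ^ 2 - a ^ 2 * Real.cos (p 2) ^ 2 < (p 1 - M (p 0)) ^ 2 :=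
    (Real.sqrt_lt' ((Real.sqrt_nonneg _).trans_lt h1)).mp h1
  unfold rhoSq
  linarith

theorem isKodamaLike_of_eqOn_K (hM : IsMassFunction a M) {X : VectorField} {c : ℝ} (hc : c ≠ 0)
    (hX : ∀ q ∈ chart, X q = c • K q) : IsKodamaLike a M X where
  smooth := by
    have h : ContDiffOn ℝ ∞ (fun _ : Coord => c • (Pi.single 0 1 : Coord)) (ergoExterior a M) :=
      contDiffOn_const
    exact h.congr fun q hq => hX q hq.1
  timelike p hp := by
    have h := rhoSq_pos (a := a) hp.1
    have h1 : normSq (metric a M) X p = c ^ 2 * metric a M p 0 0 := by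
      simp only [normSq, lower_of_eqOn_K (hX p hp.1)]
      simp [hX p hp.1, K, Fin.sum_univ_four]
      ring
    have h2 : 2 * M (p 0) * p 1 / rhoSq a p < 1 :=
      (div_lt_one h).mpr (two_mul_mass_mul_lt_rhoSq hp)
    have h3 : metric a M p 0 0 = -(1 - 2 * M (p 0) * p 1 / rhoSq a p) := rfl
    rw [h1, h3]
    exact mul_neg_of_pos_of_neg (by positivity) (by linarith)
  divergence_free p hp := divergence_of_eqOn_K hM.1 hX hp.1
  tangent p hp := by
    simp [hX p hp.1, K, pderiv_coord]
  conserved p hp := divergence_current_of_eqOn_K hM.1 hX hp.1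

/-! ### Killing fields of the Kerr metric -/

theorem differentiableAt_metric (hM : ContDiff ℝ ∞ M) (hp : p ∈ chart) (μ ν : Fin 4) :
    DifferentiableAt ℝ (fun q => metric a M q μ ν) p :=
  (Expr.differentiableAt_eval a _ hM hp).congr_of_eventuallyEq
    (Filter.eventuallyEq_of_mem (isOpen_chart.mem_nhds hp) fun _ hq => metric_eq_eval hq μ ν)

theorem contDiffAt_component (hξ : ContDiffOn ℝ ∞ ξ chart) (hp : p ∈ chart) (μ : Fin 4) :
    ContDiffAt ℝ ∞ (fun q => ξ q μ) p :=
  contDiffAt_pi.mp (hξ.contDiffAt (isOpen_chart.mem_nhds hp)) μ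

theorem differentiableAt_component (hξ : ContDiffOn ℝ ∞ ξ chart) (hp : p ∈ chart) (μ : Fin 4) :
    DifferentiableAt ℝ (fun q => ξ q μ) p :=
  (contDiffAt_component hξ hp μ).differentiableAt (by simp)

/-- The inverse metric in the Christoffel symbol cancels against the lowering of `X`, leaving only
first derivatives of the metric. -/
theorem christoffel_contract_lower (hp : p ∈ chart) (μ ν : Fin 4) (X : VectorField) :
    ∑ l, christoffel (metric a M) l μ ν p * lower (metric a M) X l p
      = (1 / 2) * ∑ σ, X p σ * (pderiv μ (fun q => metric a M q σ ν) p
        + pderiv ν (fun q => metric a M q σ μ) p - pderiv σ (fun q => metric a M q μ ν) p) := by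
  have hinv : (metric a M p)⁻¹.transpose * metric a M p = 1 := by
    have hs : (metric a M p).transpose = metric a M p := Matrix.ext fun i j => metric_symm a M p j i
    rw [Matrix.transpose_nonsing_inv, hs, Matrix.inv_eq_right_inv (metric_mul_inverse hp)]
    exact mul_eq_one_comm.mp (metric_mul_inverse hp)
  have hl : ∀ σ, ∑ l, (metric a M p)⁻¹ l σ * lower (metric a M) X l p = X p σ := by
    intro σ
    have h1 := congrFun (congrArg (fun A => A.mulVec (X p)) hinv) σ
    rw [← Matrix.mulVec_mulVec, Matrix.one_mulVec] at h1
    exact h1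
  simp only [christoffel, Finset.mul_sum, Finset.sum_mul]
  rw [Finset.sum_comm]
  refine Finset.sum_congr rfl fun σ _ => ?_
  rw [← hl σ, Finset.sum_mul, Finset.mul_sum]
  exact Finset.sum_congr rfl fun l _ => by ring

/-- Killing's equation in terms of partial derivatives: the Lie derivative of the metric
vanishes. -/
theorem IsKillingOn.lie_metric (hM : ContDiff ℝ ∞ M) (hξ : IsKillingOn (metric a M) ξ chart)
    (hp : p ∈ chart) (μ ν : Fin 4) :
    ∑ l, (ξ p l * pderiv l (fun q => metric a M q μ ν) p
      + metric a M p l ν * pderiv μ (fun q => ξ q l) p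
      + metric a M p μ l * pderiv ν (fun q => ξ q l) p) = 0 := by
  have hlow : ∀ α β, pderiv α (lower (metric a M) ξ β) p
      = ∑ l, (metric a M p β l * pderiv α (fun q => ξ q l) p
        + ξ p l * pderiv α (fun q => metric a M q β l) p) := by
    intro α β
    have hd : ∀ l, DifferentiableAt ℝ (fun q => metric a M q β l) p :=
      differentiableAt_metric hM hp β
    have hx := differentiableAt_component hξ.1 hp
    have := pderiv_sum (s := Finset.univ) (f := fun l q => metric a M q β l * ξ q l)
      (fun l _ => (hd l).mul (hx l)) α
    refine this.trans (Finset.sum_congr rfl fun l _ => pderiv_mul (hd l) (hx l) α)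
  have h := hξ.2 p hp μ ν
  rw [covDerivLower, covDerivLower, christoffel_contract_lower hp, christoffel_contract_lower hp,
    hlow, hlow] at h
  have hs : ∀ σ α β, pderiv σ (fun q => metric a M q α β) p
      = pderiv σ (fun q => metric a M q β α) p := by
    intro σ α β
    congr 1
    exact funext fun q => metric_symm a M q α β
  rw [← h]
  simp only [Fin.sum_univ_four]
  simp only [hs _ ν μ, hs _ μ 0, hs _ ν 0, hs _ μ 1, hs _ ν 1, hs _ μ 2, hs _ ν 2, hs _ μ 3,
    hs _ ν 3, metric_symm a M p _ ν]
  ring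

/-- The component `ξ_r = ξ^v - a sin² ϑ ξ^ψ`. -/
def radial (a : ℝ) (ξ : VectorField) (p : Coord) : ℝ :=
  ξ p 0 - a * Real.sin (p 2) ^ 2 * ξ p 3

theorem contDiffAt_radial (hξ : ContDiffOn ℝ ∞ ξ chart) (hp : p ∈ chart) :
    ContDiffAt ℝ ∞ (radial a ξ) p := by
  have h2 : ContDiff ℝ ∞ fun q : Coord => a * Real.sin (q 2) ^ 2 := by fun_prop
  exact (contDiffAt_component hξ hp 0).sub (h2.contDiffAt.mul (contDiffAt_component hξ hp 3))

theorem pderiv_radial (hξ : ContDiffOn ℝ ∞ ξ chart) (hp : p ∈ chart) (μ : Fin 4) :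
    pderiv μ (radial a ξ) p = pderiv μ (fun q => ξ q 0) p
      - (a * Real.sin (p 2) ^ 2 * pderiv μ (fun q => ξ q 3) p
        + ξ p 3 * if μ = 2 then 2 * a * Real.sin (p 2) * Real.cos (p 2) else 0) := by
  have hd : DifferentiableAt ℝ (fun q : Coord => a * Real.sin (q 2) ^ 2) p := by fun_prop
  have h0 : pderiv μ (fun q : Coord => a * Real.sin (q 2) ^ 2) p
      = if μ = 2 then 2 * a * Real.sin (p 2) * Real.cos (p 2) else 0 := by
    have h1 := Expr.pderiv_eval a (Expr.const a * Expr.s * Expr.s) μ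
      (M := fun _ => 0) contDiff_const hp
    have h2 : (Expr.const a * Expr.s * Expr.s).eval a (fun _ => 0)
        = fun q : Coord => a * Real.sin (q 2) ^ 2 := by
      funext q
      simp
      ring
    rw [← h2, h1]
    split_ifs with h3 <;> simp [h3]
    ring
  have hm : DifferentiableAt ℝ (fun q : Coord => a * Real.sin (q 2) ^ 2 * ξ q 3) p :=
    hd.mul (differentiableAt_component hξ hp 3)
  unfold radial
  rw [pderiv_sub (differentiableAt_component hξ hp 0) hm,
    pderiv_mul hd (differentiableAt_component hξ hp 3), h0]

/-- This is the `rr` Killing equation: `g_rr = 0`, and the other `g_rμ` do not depend on `r`. -/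
theorem pderiv_r_radial (hξ : IsKillingOn (metric a fun _ => m) ξ chart)
    (hp : p ∈ chart) :
    pderiv 1 (radial a ξ) p = 0 := by
  have h := hξ.lie_metric contDiff_const hp 1 1
  rw [pderiv_radial hξ.1 hp]
  simp only [pderiv_metric contDiff_const hp, metric_eq_eval hp, Fin.sum_univ_four] at h
  simp [Expr.metric] at h ⊢
  linarith

/-- In the `vr` equation the mass multiplies only `∂_r ξ_r = 0` and so drops out. The same happens
in the `rψ` equation below. -/
theorem pderiv_r_component_r (hξ : IsKillingOn (metric a fun _ => m) ξ chart)
    (hp : p ∈ chart) :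
    pderiv 1 (fun q => ξ q 1) p
      = a * Real.sin (p 2) ^ 2 * pderiv 1 (fun q => ξ q 3) p - pderiv 0 (radial a ξ) p := by
  have h := hξ.lie_metric contDiff_const hp 0 1
  have h1 := pderiv_r_radial hξ hp
  rw [pderiv_radial hξ.1 hp] at h1 ⊢
  simp only [pderiv_metric contDiff_const hp, metric_eq_eval hp, Fin.sum_univ_four] at h
  simp [Expr.metric] at h h1 ⊢
  linear_combination h - (2 * Expr.pot.eval a (fun _ => m) p - 1) * h1

theorem pderiv_r_component_theta (hξ : IsKillingOn (metric a fun _ => m) ξ chart)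
    (hp : p ∈ chart) :
    rhoSq a p * pderiv 1 (fun q => ξ q 2) p
      = -pderiv 2 (radial a ξ) p - 2 * a * Real.sin (p 2) * Real.cos (p 2) * ξ p 3 := by
  have h := hξ.lie_metric contDiff_const hp 1 2
  rw [pderiv_radial hξ.1 hp]
  simp only [pderiv_metric contDiff_const hp, metric_eq_eval hp, Fin.sum_univ_four] at h
  simp [Expr.metric, Expr.rho] at h ⊢
  simp only [rhoSq]
  linear_combination h

theorem pderiv_r_component_psi (hξ : IsKillingOn (metric a fun _ => m) ξ chart)
    (hp : p ∈ chart) :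
    Gam a p * Real.sin (p 2) ^ 2 * pderiv 1 (fun q => ξ q 3) p
      = a * Real.sin (p 2) ^ 2 * pderiv 1 (fun q => ξ q 1) p
        + 2 * a * Real.sin (p 2) * Real.cos (p 2) * ξ p 2 - pderiv 3 (radial a ξ) p := by
  have h := hξ.lie_metric contDiff_const hp 1 3
  have h1 := pderiv_r_radial hξ hp
  rw [pderiv_radial hξ.1 hp] at h1 ⊢
  simp only [pderiv_metric contDiff_const hp, metric_eq_eval hp, Fin.sum_univ_four] at h
  simp [Expr.metric, Expr.gam] at h h1 ⊢
  simp only [Gam]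
  linear_combination h + 2 * a * Expr.pot.eval a (fun _ => m) p * Real.sin (p 2) ^ 2 * h1

theorem killing_v_theta (hξ : IsKillingOn (metric a fun _ => m) ξ chart)
    (hp : p ∈ chart) :
    rhoSq a p * pderiv 0 (fun q => ξ q 2) p + pderiv 2 (fun q => ξ q 1) p
      = (1 - 2 * (m * p 1 / rhoSq a p)) * pderiv 2 (fun q => ξ q 0) p
        + 2 * a * (m * p 1 / rhoSq a p) * Real.sin (p 2) ^ 2 * pderiv 2 (fun q => ξ q 3) p := by
  have h := hξ.lie_metric contDiff_const hp 0 2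
  simp only [pderiv_metric contDiff_const hp, metric_eq_eval hp, Fin.sum_univ_four] at h
  simp [Expr.metric, Expr.rho, Expr.pot] at h ⊢
  simp only [rhoSq] at h ⊢
  linear_combination h

theorem killing_v_psi_of_eq_zero (hξ : IsKillingOn (metric a fun _ => m) ξ chart)
    (hp : p ∈ chart)
    (ha : a = 0) :
    p 1 ^ 2 * Real.sin (p 2) ^ 2 * pderiv 0 (fun q => ξ q 3) p + pderiv 3 (fun q => ξ q 1) p
      = (1 - 2 * (m * p 1 / rhoSq a p)) * pderiv 3 (fun q => ξ q 0) p := by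
  have h := hξ.lie_metric contDiff_const hp 0 3
  simp only [pderiv_metric contDiff_const hp, metric_eq_eval hp, Fin.sum_univ_four] at h
  simp [Expr.metric, Expr.gam, Expr.pot, ha] at h ⊢
  linear_combination h

/-- The squared norm of a field that is tangent to the surfaces of constant `r`. -/
theorem normSq_metric (hp : p ∈ chart) (X : VectorField) (hX : X p 1 = 0) :
    normSq (metric a M) X p = -X p 0 ^ 2 + rhoSq a p * X p 2 ^ 2
      + Gam a p * Real.sin (p 2) ^ 2 * X p 3 ^ 2
      + 2 * (M (p 0) * p 1 / rhoSq a p) * radial a X p ^ 2 := by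
  simp only [normSq, lower, metric_eq_eval hp, Fin.sum_univ_four, hX, radial]
  simp [Expr.metric, Expr.rho, Expr.gam, Expr.pot, rhoSq, Gam]
  ring

/-! ### Radial lines -/

theorem update_mem_chart (hp : p ∈ chart) {r : ℝ} (hr : 0 < r) :
    Function.update p 1 r ∈ chart := by
  obtain ⟨-, h2, h3⟩ := hp
  exact ⟨by simpa using hr, by simpa using h2, by simpa using h3⟩

/-- The region `r > 2 M(v)`, which lies outside the ergoregion for every rotation parameter. -/
def far (M : ℝ → ℝ) : Set Coord := {p ∈ chart | 2 * M (p 0) < p 1}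

theorem isOpen_far (hM : ContDiff ℝ ∞ M) : IsOpen (far M) :=
  isOpen_chart.inter <| isOpen_lt
    (continuous_const.mul (hM.continuous.comp (continuous_apply 0))) (continuous_apply 1)

theorem far_subset_ergoExterior (hM : IsMassFunction a M) : far M ⊆ ergoExterior a M := by
  rintro p ⟨hp, h⟩
  refine ⟨hp, ?_⟩
  have h1 : Real.sqrt (M (p 0) ^ 2 - a ^ 2 * Real.cos (p 2) ^ 2) ≤ M (p 0) :=
    Real.sqrt_le_iff.mpr ⟨(hM.2 _).1.le, by nlinarith [sq_nonneg (a * Real.cos (p 2))]⟩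
  unfold rErgo
  linarith

theorem update_mem_far (hM : ∀ v, 0 < M v) (hp : p ∈ chart) {r : ℝ} (hr : 2 * M (p 0) < r) :
    Function.update p 1 r ∈ far M :=
  ⟨update_mem_chart hp (by linarith [hM (p 0)]), by simpa using hr⟩

theorem eq_of_pderiv_r_eq_zero {F : Coord → ℝ} {R : ℝ}
    (hd : ∀ r, R < r → DifferentiableAt ℝ F (Function.update p 1 r))
    (h0 : ∀ r, R < r → pderiv 1 F (Function.update p 1 r) = 0) {r₁ r₂ : ℝ} (h₁ : R < r₁)
    (h₂ : R < r₂) : F (Function.update p 1 r₁) = F (Function.update p 1 r₂) :=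
  isOpen_Ioi.is_const_of_deriv_eq_zero (s := Set.Ioi R)
    (f := fun r => F (Function.update p 1 r)) isPreconnected_Ioi
    (fun r hr => (hasDerivAt_update (hd r hr)).differentiableAt.differentiableWithinAt)
    (fun r hr => (hasDerivAt_update (hd r hr)).deriv.trans (h0 r hr)) h₁ h₂

theorem pderiv_eq_zero_of_eqOn_zero {U : Set Coord} (hU : IsOpen U) {F : Coord → ℝ}
    (h : ∀ q ∈ U, F q = 0) (hp : p ∈ U) (μ : Fin 4) : pderiv μ F p = 0 :=
  (pderiv_congr_on hU h hp μ).trans (pderiv_const 0 μ p)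

theorem pderiv_neg (f : Coord → ℝ) (μ : Fin 4) (p : Coord) :
    pderiv μ (fun q => -f q) p = -pderiv μ f p := by
  simp [pderiv, fderiv_fun_neg]

/-! ### Elementary growth estimates -/

theorem affine_eq_zero_of_sq_mul_sq_le {α β R C : ℝ}
    (h : ∀ r, R < r → (α * r + β) ^ 2 * r ^ 2 ≤ C) : α = 0 ∧ β = 0 := by
  have h1 : Filter.Tendsto (fun r : ℝ => α * r + β) Filter.atTop (nhds 0) := by
    have h2 : Filter.Tendsto (fun r : ℝ => Real.sqrt C * r⁻¹) Filter.atTop (nhds 0) := by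
      simpa using tendsto_inv_atTop_zero.const_mul (Real.sqrt C)
    refine squeeze_zero_norm' ?_ h2
    filter_upwards [Filter.eventually_gt_atTop R, Filter.eventually_gt_atTop 0] with r hr h0
    rw [Real.norm_eq_abs, ← div_eq_mul_inv, le_div_iff₀ h0]
    refine Real.le_sqrt_of_sq_le ?_
    rw [mul_pow, sq_abs]
    exact h r hr
  have h3 := (h1.comp (Filter.tendsto_atTop_add_const_right _ (1 : ℝ) Filter.tendsto_id)).sub h1
  have h4 : α = 0 := by
    refine tendsto_nhds_unique (tendsto_const_nhds (f := Filter.atTop (α := ℝ))) ?_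
    convert h3 using 2
    · simp
      ring
    · simp
  subst h4
  refine ⟨rfl, tendsto_nhds_unique (tendsto_const_nhds (f := Filter.atTop (α := ℝ))) ?_⟩
  simpa using h1

/-- The left side grows at least like `r²` unless `κ = 0`, while the right side is bounded by `|δ|`
for `r > 2m`. Once `κ = 0`, the positive factor in front of `δ` can be divided out. -/
theorem eq_zero_of_quadratic_growth {κ δ R : ℝ} {ρ : ℝ → ℝ} (hm : 0 < m)
    (hρ : ∀ r, r ^ 2 ≤ ρ r) (h : ∀ r, R < r → ρ r * κ = (1 - 2 * (m * r / ρ r)) * δ) : δ = 0 := by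
  have hb : ∀ r, 2 * m < r → 0 < 1 - 2 * (m * r / ρ r) ∧ 1 - 2 * (m * r / ρ r) ≤ 1 := by
    intro r hr
    have h0 : 0 < r := by linarith
    have h1 : 0 < ρ r := lt_of_lt_of_le (by positivity) (hρ r)
    have h2 : m * r / ρ r < 1 / 2 := by
      rw [div_lt_iff₀ h1]
      nlinarith [hρ r]
    have h3 : 0 ≤ m * r / ρ r := by positivity
    constructor <;> linarith
  have hκ : κ = 0 := by
    refine (affine_eq_zero_of_sq_mul_sq_le (α := 0) (R := max R (max (2 * m) 1)) (C := δ ^ 2) ?_).2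
    intro r hr
    simp only [max_lt_iff] at hr
    obtain ⟨h1, h2, h3⟩ := hr
    obtain ⟨hb1, hb2⟩ := hb r h2
    have h4 : (ρ r * κ) ^ 2 ≤ δ ^ 2 := by
      rw [h r h1, mul_pow]
      exact mul_le_of_le_one_left (sq_nonneg _) (pow_le_one₀ hb1.le hb2)
    have h5 : r ≤ ρ r := le_trans (by nlinarith) (hρ r)
    have h6 : r ^ 2 ≤ ρ r ^ 2 := pow_le_pow_left₀ (by linarith) h5 2
    nlinarith [mul_le_mul_of_nonneg_left h6 (sq_nonneg κ)]
  have h1 := h (max R (2 * m) + 1) (by linarith [le_max_left R (2 * m)])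
  have h2 := (hb (max R (2 * m) + 1) (by linarith [le_max_right R (2 * m)])).1
  rw [hκ, mul_zero] at h1
  exact (mul_eq_zero.mp h1.symm).resolve_left h2.ne'

/-! ### Killing fields that are timelike and tangent to the surfaces of constant `r` far out -/

theorem radial_update (hξ : IsKillingOn (metric a fun _ => m) ξ chart) (hp : p ∈ chart) {r : ℝ}
    (hr : 0 < r) : radial a ξ (Function.update p 1 r) = radial a ξ p := by
  have h := eq_of_pderiv_r_eq_zero (F := radial a ξ) (p := p) (R := 0)
    (fun r hr => (contDiffAt_radial hξ.1 (update_mem_chart hp hr)).differentiableAt (by simp))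
    (fun r hr => pderiv_r_radial hξ (update_mem_chart hp hr)) hr hp.1
  rwa [Function.update_eq_self] at h

theorem pderiv_radial_update (hξ : IsKillingOn (metric a fun _ => m) ξ chart) (hp : p ∈ chart)
    (μ : Fin 4) {r : ℝ} (hr : 0 < r) :
    pderiv μ (radial a ξ) (Function.update p 1 r) = pderiv μ (radial a ξ) p := by
  have h := eq_of_pderiv_r_eq_zero (F := pderiv μ (radial a ξ)) (p := p) (R := 0)
    (fun r hr => (contDiffAt_pderiv
      (contDiffAt_radial hξ.1 (update_mem_chart hp hr)) μ).differentiableAt (by simp))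
    (fun r hr => by
      have hq := update_mem_chart hp hr
      rw [pderiv_comm (contDiffAt_radial hξ.1 hq)]
      exact pderiv_eq_zero_of_eqOn_zero isOpen_chart (fun q hq => pderiv_r_radial hξ hq) hq μ)
    hr hp.1
  rwa [Function.update_eq_self] at h

/-- Put `ξ^v = A + a sin² ϑ ξ^ψ` into the negative norm and drop the mass term. The bound `(x + y)²
≤ 2x² + 2y²` costs `2 a² sin² ϑ (ξ^ψ)²`, which `r ≥ 2|a|` absorbs; this gives the constant `4 A²`.
-/
theorem angular_bound (hM : ∀ v, 0 < M v) (hξ : IsKillingOn (metric a fun _ => m) ξ chart)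
    (hT : ∀ q ∈ far M, ξ q 1 = 0) (hN : ∀ q ∈ far M, normSq (metric a M) ξ q < 0)
    (hp : p ∈ chart) : ∃ C R, 2 * M (p 0) ≤ R ∧ ∀ r, R < r →
      (ξ (Function.update p 1 r) 2 ^ 2
        + Real.sin (p 2) ^ 2 * ξ (Function.update p 1 r) 3 ^ 2) * r ^ 2 ≤ C := by
  refine ⟨4 * radial a ξ p ^ 2, max (2 * M (p 0)) (2 * |a|), le_max_left _ _, fun r hr => ?_⟩
  rw [max_lt_iff] at hr
  have hq := update_mem_far hM hp hr.1
  have hr0 : 0 < r := by linarith [hM (p 0)]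
  have h := hN _ hq
  rw [normSq_metric hq.1 ξ (hT _ hq)] at h
  have hA := radial_update hξ hp hr0
  have hV : ξ (Function.update p 1 r) 0 = radial a ξ p
      + a * Real.sin (p 2) ^ 2 * ξ (Function.update p 1 r) 3 := by
    rw [← hA]
    simp [radial]
  have hpos : 0 ≤ M (p 0) * r / rhoSq a (Function.update p 1 r)
      * radial a ξ (Function.update p 1 r) ^ 2 := by
    have := rhoSq_pos (a := a) hq.1
    have := hM (p 0)
    positivity
  have ha : 4 * a ^ 2 ≤ r ^ 2 := by
    have := pow_le_pow_left₀ (by positivity) hr.2.le 2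
    rw [mul_pow, sq_abs] at this
    linarith
  rw [hV] at h
  simp only [Function.update_self, rhoSq, Gam, ne_eq, Fin.reduceEq, not_false_eq_true,
    Function.update_of_ne] at h hpos
  set Ψ := ξ (Function.update p 1 r) 3
  set Θ := ξ (Function.update p 1 r) 2
  set A := radial a ξ p
  set s := Real.sin (p 2)
  have hs : s ^ 2 ≤ 1 := Real.sin_sq_le_one _
  have h1 : (A + a * s ^ 2 * Ψ) ^ 2 ≤ 2 * A ^ 2 + 2 * (a ^ 2 * (s ^ 2 * Ψ ^ 2)) := by
    have h2 : (a * s ^ 2 * Ψ) ^ 2 ≤ a ^ 2 * (s ^ 2 * Ψ ^ 2) := by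
      have h3 : 0 ≤ a ^ 2 * (s ^ 2 * Ψ ^ 2) := by positivity
      nlinarith [mul_le_mul_of_nonneg_left hs h3]
    nlinarith [sq_nonneg (A - a * s ^ 2 * Ψ)]
  have h2 : 0 ≤ (r ^ 2 - 4 * a ^ 2) * (s ^ 2 * Ψ ^ 2) :=
    mul_nonneg (by linarith) (by positivity)
  have h3 : 0 ≤ a ^ 2 * Real.cos (p 2) ^ 2 * Θ ^ 2 := by positivity
  have h4 : 0 ≤ a ^ 2 * (s ^ 2 * Ψ ^ 2) := by positivity
  have h5 : 0 ≤ r ^ 2 * Θ ^ 2 := by positivity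
  linarith

/-- With `ξ^r = 0` the `vr` equation makes `a sin² ϑ ξ^ψ` affine in `r` with slope `∂_v A`; decay
kills both coefficients. -/
theorem pderiv_v_radial_of_ne_zero (hM : IsMassFunction a M)
    (hξ : IsKillingOn (metric a fun _ => m) ξ chart) (hT : ∀ q ∈ far M, ξ q 1 = 0)
    (hN : ∀ q ∈ far M, normSq (metric a M) ξ q < 0) (hp : p ∈ far M) (ha : a ≠ 0) :
    pderiv 0 (radial a ξ) p = 0 ∧ ξ p 3 = 0 := by
  have hs := (sin_pos_of_mem_chart hp.1).ne'
  set α := pderiv 0 (radial a ξ) p with hα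
  obtain ⟨C, R, hR, hb⟩ := angular_bound (fun v => (hM.2 v).1) hξ hT hN hp.1
  have hF : ∀ r, 2 * M (p 0) < r → a * Real.sin (p 2) ^ 2 * ξ (Function.update p 1 r) 3 - α * r
      = a * Real.sin (p 2) ^ 2 * ξ p 3 - α * p 1 := by
    intro r hr
    have hder : ∀ r, 2 * M (p 0) < r → HasDerivAt (fun r => a * Real.sin (p 2) ^ 2
        * ξ (Function.update p 1 r) 3 - α * r) 0 r := by
      intro r hr
      have hq := update_mem_far (fun v => (hM.2 v).1) hp.1 hr
      have h1 := ((hasDerivAt_update (differentiableAt_component hξ.1 hq.1 3)).const_mul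
        (a * Real.sin (p 2) ^ 2)).sub ((hasDerivAt_id r).const_mul α)
      refine h1.congr_deriv ?_
      have h2 := pderiv_r_component_r hξ hq.1
      rw [pderiv_eq_zero_of_eqOn_zero (isOpen_far hM.1) hT hq,
        pderiv_radial_update hξ hp.1 0 (by linarith [(hM.2 (p 0)).1])] at h2
      simp at h2
      linarith
    have := isOpen_Ioi.is_const_of_deriv_eq_zero (s := Set.Ioi (2 * M (p 0))) isPreconnected_Ioi
      (fun r hr => (hder r hr).differentiableAt.differentiableWithinAt)
      (fun r hr => (hder r hr).deriv) hr hp.2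
    simpa using this
  have h1 := affine_eq_zero_of_sq_mul_sq_le (α := α)
    (β := a * Real.sin (p 2) ^ 2 * ξ p 3 - α * p 1) (R := R) (C := a ^ 2 * C) (by
      intro r hr
      have h2 : α * r + (a * Real.sin (p 2) ^ 2 * ξ p 3 - α * p 1)
          = a * Real.sin (p 2) ^ 2 * ξ (Function.update p 1 r) 3 := by
        rw [← hF r (hR.trans_lt hr)]
        ring
      rw [h2]
      refine le_trans ?_ (mul_le_mul_of_nonneg_left (hb r hr) (sq_nonneg a))
      set Ψ := ξ (Function.update p 1 r) 3
      set Θ := ξ (Function.update p 1 r) 2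
      have h3 : 0 ≤ a ^ 2 * (Θ ^ 2 * r ^ 2) := by positivity
      have h4 : 0 ≤ a ^ 2 * (Real.sin (p 2) ^ 2 * Ψ ^ 2) * r ^ 2 := by positivity
      nlinarith [mul_le_mul_of_nonneg_left (Real.sin_sq_le_one (p 2)) h4])
  refine ⟨h1.1, ?_⟩
  have h2 := h1.2
  rw [h1.1, zero_mul, sub_zero] at h2
  exact (mul_eq_zero.mp h2).resolve_left (by positivity)

/-- The product `a ξ^ψ` lets later steps treat zero and nonzero rotation together. -/
theorem pderiv_v_radial (hM : IsMassFunction a M)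
    (hξ : IsKillingOn (metric a fun _ => m) ξ chart) (hT : ∀ q ∈ far M, ξ q 1 = 0)
    (hN : ∀ q ∈ far M, normSq (metric a M) ξ q < 0) (hp : p ∈ far M) :
    pderiv 0 (radial a ξ) p = 0 ∧ a * ξ p 3 = 0 := by
  rcases eq_or_ne a 0 with rfl | ha
  · have h := pderiv_r_component_r hξ hp.1
    rw [pderiv_eq_zero_of_eqOn_zero (isOpen_far hM.1) hT hp] at h
    constructor
    · linarith
    · ring
  · have h := pderiv_v_radial_of_ne_zero hM hξ hT hN hp ha
    exact ⟨h.1, by rw [h.2, mul_zero]⟩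

/-- If `f ∂_r F` is independent of `v` for a nowhere vanishing `f` that is independent of `v`,
then `∂_v F` is independent of `r`. -/
theorem pderiv_r_pderiv_v_eq_zero {U : Set Coord} (hU : IsOpen U) {F G f : Coord → ℝ}
    (hF : ContDiffAt ℝ ∞ F p) (hf : DifferentiableAt ℝ f p) (hfv : pderiv 0 f p = 0)
    (hf0 : f p ≠ 0) (hp : p ∈ U) (hG : pderiv 0 G p = 0)
    (h : ∀ q ∈ U, f q * pderiv 1 F q = G q) : pderiv 1 (pderiv 0 F) p = 0 := by
  have h1 := pderiv_congr_on hU h hp 0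
  rw [pderiv_mul hf ((contDiffAt_pderiv hF 1).differentiableAt (by simp)), hfv, hG, mul_zero,
    add_zero] at h1
  rw [pderiv_comm hF]
  exact (mul_eq_zero.mp h1).resolve_left hf0

theorem pderiv_v_pderiv_radial (hM : IsMassFunction a M)
    (hξ : IsKillingOn (metric a fun _ => m) ξ chart) (hT : ∀ q ∈ far M, ξ q 1 = 0)
    (hN : ∀ q ∈ far M, normSq (metric a M) ξ q < 0) (hp : p ∈ far M) (μ : Fin 4) :
    pderiv 0 (fun q => -pderiv μ (radial a ξ) q) p = 0 := by
  have h : pderiv 0 (pderiv μ (radial a ξ)) p = 0 := by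
    rw [pderiv_comm (contDiffAt_radial hξ.1 hp.1)]
    exact pderiv_eq_zero_of_eqOn_zero (isOpen_far hM.1)
      (fun q hq => (pderiv_v_radial hM hξ hT hN hq).1) hp μ
  rw [pderiv_neg, h, neg_zero]

/-- The `rϑ` equation becomes `ρ² ∂_r ξ^ϑ = -∂_ϑ A`, with right side independent of `v`, so `∂_v
ξ^ϑ` does not depend on `r`. The `vϑ` equation reads `ρ² ∂_v ξ^ϑ = (1 - 2mr/ρ²) ∂_ϑ A`, and
comparing growth in `r` gives the result. -/
theorem pderiv_theta_radial (hm : 0 < m) (hM : IsMassFunction a M)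
    (hξ : IsKillingOn (metric a fun _ => m) ξ chart) (hT : ∀ q ∈ far M, ξ q 1 = 0)
    (hN : ∀ q ∈ far M, normSq (metric a M) ξ q < 0) (hp : p ∈ far M) :
    pderiv 2 (radial a ξ) p = 0 := by
  have hrho : ∀ q ∈ far M, DifferentiableAt ℝ (rhoSq a) q ∧ pderiv 0 (rhoSq a) q = 0 := by
    intro q hq
    have h2 : (Expr.rho a).eval a M = rhoSq a := by
      funext q
      simp [Expr.rho, rhoSq]
      ring
    rw [← h2]
    refine ⟨Expr.differentiableAt_eval a _ hM.1 hq.1, ?_⟩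
    rw [Expr.pderiv_eval a _ _ hM.1 hq.1]
    simp [Expr.rho]
  have hκ : ∀ q ∈ far M, pderiv 1 (pderiv 0 fun q => ξ q 2) q = 0 := by
    intro q hq
    refine pderiv_r_pderiv_v_eq_zero (isOpen_far hM.1) (contDiffAt_component hξ.1 hq.1 2)
      (hrho q hq).1 (hrho q hq).2 (rhoSq_pos hq.1).ne' hq
      (pderiv_v_pderiv_radial hM hξ hT hN hq 2) fun x hx => ?_
    rw [pderiv_r_component_theta hξ hx.1]
    linear_combination (-2 * Real.sin (x 2) * Real.cos (x 2))
      * (pderiv_v_radial hM hξ hT hN hx).2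
  refine eq_zero_of_quadratic_growth (R := 2 * M (p 0)) (κ := pderiv 0 (fun q => ξ q 2) p)
    (ρ := fun r => rhoSq a (Function.update p 1 r)) hm (fun r => ?_) (fun r hr => ?_)
  · simp [rhoSq]
    positivity
  · have hpos : ∀ v, 0 < M v := fun v => (hM.2 v).1
    have hq := update_mem_far hpos hp.1 hr
    have h1 := killing_v_theta hξ hq.1
    have h2 := eq_of_pderiv_r_eq_zero (F := pderiv 0 fun q => ξ q 2) (p := p)
      (fun r hr => (contDiffAt_pderiv (contDiffAt_component hξ.1
        (update_mem_far hpos hp.1 hr).1 2) 0).differentiableAt (by simp))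
      (fun r hr => hκ _ (update_mem_far hpos hp.1 hr)) hr hp.2
    rw [Function.update_eq_self] at h2
    have h3 := pderiv_radial (a := a) hξ.1 hq.1 2
    rw [pderiv_radial_update hξ hp.1 2 (by linarith [hpos (p 0)])] at h3
    have h4 : a * pderiv 2 (fun q => ξ q 3) (Function.update p 1 r) = 0 := by
      have h5 := pderiv_eq_zero_of_eqOn_zero (isOpen_far hM.1)
        (fun q hq => (pderiv_v_radial hM hξ hT hN hq).2) hq 2
      rwa [pderiv_mul (differentiableAt_const a) (differentiableAt_component hξ.1 hq.1 3),
        pderiv_const, mul_zero, add_zero] at h5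
    rw [pderiv_eq_zero_of_eqOn_zero (isOpen_far hM.1) hT hq, h2] at h1
    have h5 := (pderiv_v_radial hM hξ hT hN hq).2
    simp only [Function.update_self, ne_eq, Fin.reduceEq, not_false_eq_true,
      Function.update_of_ne, if_true] at h1 h3 h5 ⊢
    set P := m * r / rhoSq a (Function.update p 1 r)
    linear_combination h1 - (1 - 2 * P) * h3 + Real.sin (p 2) ^ 2 * h4
      + (1 - 2 * P) * 2 * Real.sin (p 2) * Real.cos (p 2) * h5

/-- Here `ξ^ψ = 0`, so the `rψ` equation equates `∂_ψ A` with a multiple of the decaying `ξ^ϑ`. -/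
theorem pderiv_psi_radial_of_ne_zero (hM : IsMassFunction a M)
    (hξ : IsKillingOn (metric a fun _ => m) ξ chart) (hT : ∀ q ∈ far M, ξ q 1 = 0)
    (hN : ∀ q ∈ far M, normSq (metric a M) ξ q < 0) (hp : p ∈ far M) (ha : a ≠ 0) :
    pderiv 3 (radial a ξ) p = 0 := by
  obtain ⟨C, R, hR, hb⟩ := angular_bound (fun v => (hM.2 v).1) hξ hT hN hp.1
  refine (affine_eq_zero_of_sq_mul_sq_le (α := 0) (R := R) (C := 4 * a ^ 2 * C) ?_).2
  intro r hr
  have hq := update_mem_far (fun v => (hM.2 v).1) hp.1 (hR.trans_lt hr)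
  have h1 := pderiv_r_component_psi hξ hq.1
  rw [pderiv_eq_zero_of_eqOn_zero (isOpen_far hM.1) hT hq,
    pderiv_eq_zero_of_eqOn_zero (isOpen_far hM.1)
      (fun q hq => (pderiv_v_radial_of_ne_zero hM hξ hT hN hq ha).2) hq,
    pderiv_radial_update hξ hp.1 3 (by linarith [(hM.2 (p 0)).1])] at h1
  simp only [ne_eq, Fin.reduceEq, not_false_eq_true, Function.update_of_ne] at h1
  have h2 : 0 * r + pderiv 3 (radial a ξ) p
      = 2 * a * Real.sin (p 2) * Real.cos (p 2) * ξ (Function.update p 1 r) 2 := by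
    linear_combination h1
  rw [h2]
  refine le_trans ?_ (mul_le_mul_of_nonneg_left (hb r hr) (by positivity))
  set Ψ := ξ (Function.update p 1 r) 3
  set Θ := ξ (Function.update p 1 r) 2
  have h3 : (Real.sin (p 2) * Real.cos (p 2)) ^ 2 ≤ 1 := by
    rw [mul_pow]
    exact mul_le_one₀ (Real.sin_sq_le_one _) (sq_nonneg _) (Real.cos_sq_le_one _)
  have h4 : 0 ≤ 4 * a ^ 2 * Θ ^ 2 * r ^ 2 := by positivity
  have h5 : 0 ≤ 4 * a ^ 2 * (Real.sin (p 2) ^ 2 * Ψ ^ 2) * r ^ 2 := by positivity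
  nlinarith [mul_le_mul_of_nonneg_left h3 h4]

/-- Without rotation the argument for `∂_ϑ A` carries over, with `r² sin² ϑ` in place of `ρ²` in the
`rψ` equation. -/
theorem pderiv_psi_radial_of_eq_zero (hm : 0 < m) (hM : IsMassFunction a M)
    (hξ : IsKillingOn (metric a fun _ => m) ξ chart) (hT : ∀ q ∈ far M, ξ q 1 = 0)
    (hN : ∀ q ∈ far M, normSq (metric a M) ξ q < 0) (hp : p ∈ far M) (ha : a = 0) :
    pderiv 3 (radial a ξ) p = 0 := by
  have hf : ∀ q ∈ far M,
      DifferentiableAt ℝ (fun x : Coord => x 1 ^ 2 * Real.sin (x 2) ^ 2) q ∧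
        pderiv 0 (fun x : Coord => x 1 ^ 2 * Real.sin (x 2) ^ 2) q = 0 := by
    intro q hq
    have h2 : (Expr.r * Expr.r * Expr.s * Expr.s).eval a M
        = fun x : Coord => x 1 ^ 2 * Real.sin (x 2) ^ 2 := by
      funext q
      simp
      ring
    rw [← h2]
    refine ⟨Expr.differentiableAt_eval a _ hM.1 hq.1, ?_⟩
    rw [Expr.pderiv_eval a _ _ hM.1 hq.1]
    simp
  have hκ : ∀ q ∈ far M, pderiv 1 (pderiv 0 fun q => ξ q 3) q = 0 := by
    intro q hq
    have hs := sin_pos_of_mem_chart hq.1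
    have hr := hq.1.1
    refine pderiv_r_pderiv_v_eq_zero (isOpen_far hM.1) (contDiffAt_component hξ.1 hq.1 3)
      (hf q hq).1 (hf q hq).2 (by positivity) hq
      (pderiv_v_pderiv_radial hM hξ hT hN hq 3) fun x hx => ?_
    have h1 := pderiv_r_component_psi hξ hx.1
    simp only [Gam, ha] at h1 ⊢
    linear_combination h1
  refine eq_zero_of_quadratic_growth (R := 2 * M (p 0))
    (κ := Real.sin (p 2) ^ 2 * pderiv 0 (fun q => ξ q 3) p)
    (ρ := fun r => rhoSq a (Function.update p 1 r)) hm (fun r => ?_) (fun r hr => ?_)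
  · simp [rhoSq]
    positivity
  · have hpos : ∀ v, 0 < M v := fun v => (hM.2 v).1
    have hq := update_mem_far hpos hp.1 hr
    have h1 := killing_v_psi_of_eq_zero hξ hq.1 ha
    have h2 := eq_of_pderiv_r_eq_zero (F := pderiv 0 fun q => ξ q 3) (p := p)
      (fun r hr => (contDiffAt_pderiv (contDiffAt_component hξ.1
        (update_mem_far hpos hp.1 hr).1 3) 0).differentiableAt (by simp))
      (fun r hr => hκ _ (update_mem_far hpos hp.1 hr)) hr hp.2
    rw [Function.update_eq_self] at h2
    have h3 := pderiv_radial (a := a) hξ.1 hq.1 3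
    rw [pderiv_radial_update hξ hp.1 3 (by linarith [hpos (p 0)])] at h3
    rw [pderiv_eq_zero_of_eqOn_zero (isOpen_far hM.1) hT hq, h2] at h1
    simp only [Function.update_self, ne_eq, Fin.reduceEq, not_false_eq_true,
      Function.update_of_ne, if_false] at h1 h3 ⊢
    have h4 : rhoSq a (Function.update p 1 r) = r ^ 2 := by simp [rhoSq, ha]
    rw [h4] at h1 ⊢
    rw [ha, zero_mul, zero_mul, mul_zero, add_zero, sub_zero] at h3
    rw [ha, h3]
    linear_combination h1

/-! ### Constancy of `ξ_r` and identification of the Killing field. -/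

theorem fderiv_radial (hm : 0 < m) (hM : IsMassFunction a M)
    (hξ : IsKillingOn (metric a fun _ => m) ξ chart) (hT : ∀ q ∈ far M, ξ q 1 = 0)
    (hN : ∀ q ∈ far M, normSq (metric a M) ξ q < 0) (hp : p ∈ far M) :
    fderiv ℝ (radial a ξ) p = 0 := by
  have h : ∀ μ, pderiv μ (radial a ξ) p = 0 := by
    intro μ
    fin_cases μ
    · exact (pderiv_v_radial hM hξ hT hN hp).1
    · exact pderiv_r_radial hξ hp.1
    · exact pderiv_theta_radial hm hM hξ hT hN hp
    · rcases eq_or_ne a 0 with ha | ha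
      · exact pderiv_psi_radial_of_eq_zero hm hM hξ hT hN hp ha
      · exact pderiv_psi_radial_of_ne_zero hM hξ hT hN hp ha
  refine ContinuousLinearMap.coe_injective (LinearMap.pi_ext' fun μ => ?_)
  exact LinearMap.ext_ring (h μ)

theorem exists_radial_eq (hm : 0 < m) (hM : IsMassFunction a M)
    (hξ : IsKillingOn (metric a fun _ => m) ξ chart) (hT : ∀ q ∈ far M, ξ q 1 = 0)
    (hN : ∀ q ∈ far M, normSq (metric a M) ξ q < 0) :
    ∃ c, ∀ p ∈ chart, radial a ξ p = c := by
  suffices h : ∀ p ∈ chart, ∀ q ∈ chart, radial a ξ p = radial a ξ q by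
    rcases chart.eq_empty_or_nonempty with h0 | ⟨q, hq⟩
    · exact ⟨0, fun p hp => by simp [h0] at hp⟩
    · exact ⟨radial a ξ q, fun p hp => h p hp q hq⟩
  intro p hp q hq
  -- The far region need not be convex and `M` may be unbounded. Both points are therefore moved
  -- radially, which leaves `ξ_r` unchanged, to `r = 2B + 1` with `B` bounding `M` between their
  -- values of `v`; there a convex box lies in the far region.
  obtain ⟨B, hB⟩ := (isCompact_uIcc (a := p 0) (b := q 0)).bddAbove_image
    (hM.1.continuous.continuousOn)
  have hB' : ∀ v ∈ Set.uIcc (p 0) (q 0), M v ≤ B := fun v hv => hB (Set.mem_image_of_mem M hv)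
  have hB0 : 0 < B := (hM.2 _).1.trans_le (hB' (p 0) Set.left_mem_uIcc)
  have hR : 0 < 2 * B + 1 := by linarith
  let t : Fin 4 → Set ℝ :=
    ![Set.uIcc (p 0) (q 0), {2 * B + 1}, Set.Ioo 0 Real.pi, Set.Ioo 0 (2 * Real.pi)]
  have ht : Convex ℝ (Set.pi Set.univ t) := by
    refine convex_pi fun i _ => ?_
    fin_cases i
    · exact convex_uIcc _ _
    · exact convex_singleton _
    · exact convex_Ioo _ _
    · exact convex_Ioo _ _
  have hfar : ∀ x ∈ Set.pi Set.univ t, x ∈ far M := by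
    intro x hx
    have h0 : x 0 ∈ Set.uIcc (p 0) (q 0) := hx 0 trivial
    have h1 : x 1 = 2 * B + 1 := hx 1 trivial
    refine ⟨⟨h1 ▸ hR, hx 2 trivial, hx 3 trivial⟩, ?_⟩
    rw [h1]
    linarith [hB' _ h0]
  have hmem : ∀ x ∈ chart, x 0 ∈ Set.uIcc (p 0) (q 0) →
      Function.update x 1 (2 * B + 1) ∈ Set.pi Set.univ t := by
    intro x hx h0 i _
    fin_cases i
    · simpa [t] using h0
    · simp [t]
    · simpa [t] using hx.2.1
    · simpa [t] using hx.2.2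
  have key := ht.norm_image_sub_le_of_norm_hasFDerivWithin_le (C := 0) (f := radial a ξ)
    (f' := fun _ => 0)
    (fun x hx => by
      rw [← fderiv_radial hm hM hξ hT hN (hfar x hx)]
      exact ((contDiffAt_radial hξ.1 (hfar x hx).1).differentiableAt
        (by simp)).hasFDerivAt.hasFDerivWithinAt)
    (fun x hx => by simp) (hmem q hq Set.right_mem_uIcc) (hmem p hp Set.left_mem_uIcc)
  rw [zero_mul, norm_le_zero_iff, sub_eq_zero, radial_update hξ hp hR,
    radial_update hξ hq hR] at key
  exact key

/-- A Killing field of the Kerr metric whose component `ξ_r` is constant has a first integral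
along radial lines. -/
theorem pderiv_r_angular (hξ : IsKillingOn (metric a fun _ => m) ξ chart) {c : ℝ}
    (hc : ∀ q ∈ chart, radial a ξ q = c) (hp : p ∈ chart) :
    pderiv 1 (fun q => ξ q 1) p = a * Real.sin (p 2) ^ 2 * pderiv 1 (fun q => ξ q 3) p ∧
    ξ p 2 * pderiv 1 (fun q => ξ q 2) p
      + Real.sin (p 2) ^ 2 * (ξ p 3 * pderiv 1 (fun q => ξ q 3) p) = 0 := by
  have h0 : ∀ μ, pderiv μ (radial a ξ) p = 0 := fun μ =>
    (pderiv_congr_on isOpen_chart hc hp μ).trans (pderiv_const c μ p)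
  have h1 := pderiv_r_component_r hξ hp
  have h2 := pderiv_r_component_theta hξ hp
  have h3 := pderiv_r_component_psi hξ hp
  rw [h0] at h1 h2 h3
  rw [sub_zero] at h1
  refine ⟨h1, ?_⟩
  have h4 := (rhoSq_pos (a := a) hp).ne'
  refine (mul_eq_zero.mp (?_ : rhoSq a p * _ = 0)).resolve_left h4
  have h5 : rhoSq a p = Gam a p - a ^ 2 * Real.sin (p 2) ^ 2 := by
    simp only [rhoSq, Gam, cos_sq_eq]
    ring
  rw [h1] at h3
  -- Together with `h2`, this says that `(ξ^ϑ, sin ϑ ξ^ψ)` rotates along the radial line, so its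
  -- length is preserved.
  have h6 : rhoSq a p * (Real.sin (p 2) ^ 2 * pderiv 1 (fun q => ξ q 3) p)
      = 2 * a * Real.sin (p 2) * Real.cos (p 2) * ξ p 2 := by
    rw [h5]
    linear_combination h3
  linear_combination ξ p 2 * h2 + ξ p 3 * h6

theorem eq_smul_K_of_timelike_tangent (hm : 0 < m) (hM : IsMassFunction a M)
    (hξ : IsKillingOn (metric a fun _ => m) ξ chart) (hT : ∀ q ∈ far M, ξ q 1 = 0)
    (hN : ∀ q ∈ far M, normSq (metric a M) ξ q < 0) :
    ∃ c : ℝ, ∀ p ∈ chart, ξ p = c • K p := by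
  obtain ⟨c, hc⟩ := exists_radial_eq hm hM hξ hT hN
  have hang : ∀ p ∈ chart, ξ p 2 = 0 ∧ ξ p 3 = 0 := by
    intro p hp
    have hd : ∀ μ, ∀ r, 0 < r → HasDerivAt (fun r => ξ (Function.update p 1 r) μ)
        (pderiv 1 (fun q => ξ q μ) (Function.update p 1 r)) r := fun μ r hr =>
      hasDerivAt_update (f := fun q => ξ q μ)
        (differentiableAt_component hξ.1 (update_mem_chart hp hr) μ)
    have hder : ∀ r, 0 < r → HasDerivAt (fun r => ξ (Function.update p 1 r) 2 ^ 2
        + Real.sin (p 2) ^ 2 * ξ (Function.update p 1 r) 3 ^ 2) 0 r := by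
      intro r hr
      refine (((hd 2 r hr).pow 2).add (((hd 3 r hr).pow 2).const_mul _)).congr_deriv ?_
      have h := (pderiv_r_angular hξ hc (update_mem_chart hp hr)).2
      simp only [ne_eq, Fin.reduceEq, not_false_eq_true, Function.update_of_ne] at h
      norm_num
      linear_combination 2 * h
    have hconst : ∀ r, 0 < r → ξ (Function.update p 1 r) 2 ^ 2
        + Real.sin (p 2) ^ 2 * ξ (Function.update p 1 r) 3 ^ 2
        = ξ p 2 ^ 2 + Real.sin (p 2) ^ 2 * ξ p 3 ^ 2 := by
      intro r hr
      have := isOpen_Ioi.is_const_of_deriv_eq_zero (s := Set.Ioi 0) isPreconnected_Ioi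
        (fun r hr => (hder r hr).differentiableAt.differentiableWithinAt)
        (fun r hr => (hder r hr).deriv) hr hp.1
      simpa using this
    obtain ⟨C, R, hR, hb⟩ := angular_bound (fun v => (hM.2 v).1) hξ hT hN hp
    -- The conserved quantity is the square of the constant `β`, so the `1/r²` decay forces it to
    -- vanish.
    have h1 := (affine_eq_zero_of_sq_mul_sq_le (α := 0) (R := R)
      (β := Real.sqrt (ξ p 2 ^ 2 + Real.sin (p 2) ^ 2 * ξ p 3 ^ 2)) (C := C) (by
        intro r hr
        have := hb r hr
        rw [hconst r (by linarith [(hM.2 (p 0)).1])] at this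
        rwa [zero_mul, zero_add, Real.sq_sqrt (by positivity)])).2
    rw [Real.sqrt_eq_zero (by positivity)] at h1
    have hs := sin_pos_of_mem_chart hp
    have h2 : ξ p 2 ^ 2 = 0 := by
      have : 0 ≤ Real.sin (p 2) ^ 2 * ξ p 3 ^ 2 := by positivity
      nlinarith [sq_nonneg (ξ p 2)]
    rw [h2, zero_add] at h1
    refine ⟨by simpa using h2, ?_⟩
    simpa [hs.ne'] using h1
  have hr : ∀ p ∈ chart, ξ p 1 = 0 := by
    intro p hp
    have h := eq_of_pderiv_r_eq_zero (F := fun q => ξ q 1) (p := p) (R := 0)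
      (r₂ := 2 * M (p 0) + 1)
      (fun r hr => differentiableAt_component hξ.1 (update_mem_chart hp hr) 1)
      (fun r hr => by
        have hq := update_mem_chart hp hr
        rw [(pderiv_r_angular hξ hc hq).1,
          pderiv_eq_zero_of_eqOn_zero isOpen_chart (fun q hq => (hang q hq).2) hq, mul_zero])
      hp.1 (by linarith [(hM.2 (p 0)).1])
    simp only [Function.update_eq_self] at h
    rw [h]
    exact hT _ (update_mem_far (fun v => (hM.2 v).1) hp (by linarith))
  refine ⟨c, fun p hp => funext fun μ => ?_⟩
  have h0 := hc p hp
  rw [radial, (hang p hp).2, mul_zero, sub_zero] at h0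
  fin_cases μ
  · simpa [K] using h0
  · simpa [K] using hr p hp
  · simpa [K] using (hang p hp).1
  · simpa [K] using (hang p hp).2

/-- Only the timelikeness of a Kodama-like field and its tangency to the surfaces of constant `r`
are needed to identify it, if it agrees with a Killing field of the Kerr metric. -/
theorem IsKodamaLike.eq_smul_K (hm : 0 < m) (hM : IsMassFunction a M)
    (hξ : IsKillingOn (metric a fun _ => m) ξ chart) {X : VectorField}
    (h : IsKodamaLike a M X) (hX : Set.EqOn X ξ (ergoExterior a M)) :
    ∃ c : ℝ, ∀ p ∈ chart, ξ p = c • K p := by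
  have hsub := far_subset_ergoExterior hM
  refine eq_smul_K_of_timelike_tangent hm hM hξ (fun q hq => ?_) (fun q hq => ?_)
  · simpa [pderiv_coord, hX (hsub hq)] using h.tangent q (hsub hq)
  · simpa only [normSq, lower, hX (hsub hq)] using h.timelike q (hsub hq)

end

end KerrVaidya

theorem proposition2 (a m : ℝ) (hm : 0 < m) (ham : |a| ≤ m)
    (ξ : KerrVaidya.VectorField)
    (hξ : KerrVaidya.IsKillingOn (KerrVaidya.metric a fun _ => m) ξ KerrVaidya.chart)
    (htime : ∃ p ∈ KerrVaidya.chart,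
      KerrVaidya.normSq (KerrVaidya.metric a fun _ => m) ξ p < 0) :
    (∀ M : ℝ → ℝ, KerrVaidya.IsMassFunction a M →
      (KerrVaidya.IsKodamaLike a M ξ ↔
        ∃ c : ℝ, ∀ p ∈ KerrVaidya.chart, ξ p = c • KerrVaidya.K p)) ∧
    (KerrVaidya.GeneralizesToKodamaLike a m ξ ↔
      ∃ c : ℝ, ∀ p ∈ KerrVaidya.chart, ξ p = c • KerrVaidya.K p) := by
  have hconst : KerrVaidya.IsMassFunction a fun _ => m := ⟨contDiff_const, fun _ => ⟨hm, ham⟩⟩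
  -- Timelikeness at one point excludes the zero field, which is not Kodama-like.
  have hne : ∀ c : ℝ, (∀ p ∈ KerrVaidya.chart, ξ p = c • KerrVaidya.K p) → c ≠ 0 := by
    rintro c hc rfl
    obtain ⟨p, hp, hlt⟩ := htime
    simp [KerrVaidya.normSq, hc p hp] at hlt
  refine ⟨fun M hM => ⟨fun h => h.eq_smul_K hm hM hξ fun _ _ => rfl, ?_⟩, ?_, ?_⟩
  · rintro ⟨c, hc⟩
    exact KerrVaidya.isKodamaLike_of_eqOn_K hM (hne c hc) hc
  · rintro ⟨X, hX, h⟩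
    -- Only the member of the family for the constant mass `m` matters.
    exact (h _ hconst).eq_smul_K hm hconst hξ hX
  · rintro ⟨c, hc⟩
    -- The same components serve for every mass function.
    exact ⟨fun _ => ξ, fun _ _ => rfl, fun M hM => KerrVaidya.isKodamaLike_of_eqOn_K hM (hne c hc) hc⟩
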